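/- Let $G$ be a finite graph and $k$ a positive integer. The $k$-recolouring graph $\mathcal{C}_k(G)$ has as vertices the proper colourings of $G$ with colours from a fixed set of $k$ colours; two of them are adjacent precisely when they differ in the colour of exactly one vertex of $G$. There are functions $g_1,g_2$ of $(k,p,q)$, with non-negative integer values, such that the following holds for all positive integers $p,q,k$ with $p\le q$ and $k\ge 3$. The graph $\mathcal{C}_k(K_{p,q})$ is connected (so its diameter is finite), $$0\le g_1(k,p,q)\le\left\lfloor \tfrac{k^2}{4}\right\rfloor,\qquad 0\le g_2(k,p,q)\le\left\lfloor \tfrac{k}{2}\right\rfloor,$$ and $$\operatorname{diam}\mathcal{C}_k(K_{p,q})=\begin{cases} 2p+q+\left\lfloor\dfrac{q-p}{k-1}\right\rfloor & \text{if } q\ge kp,\\[2mm] 3p+q+\left\lfloor\dfrac{q-kp}{\lfloor k^2/4\rfloor}\right\rfloor-g_1(k,p,q) & \text{if } \lceil k/2\rceil\, p\le q\le kp,\\[2mm] 2p+q+\left\lfloor\dfrac{q-p}{\lceil k/2\rceil}\right\rfloor-g_2(k,p,q) & \text{if } q\le\lceil k/2\rceil\, p. \end{cases}$$ At the common boundary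 values of $q$ both of the corresponding formulas hold. -/

import Mathlib

/-- The `k`-recolouring graph of `G`: its vertices are the proper colourings of `G` with colours
in `Fin k`; two of them are adjacent when they differ at exactly one vertex of `G`. -/
def recolouringGraph {V : Type*} (G : SimpleGraph V) (k : ℕ) :
    SimpleGraph (G.Coloring (Fin k)) where
  Adj α β := ∃! v, α v ≠ β v
  symm := ⟨fun α β h => by simpa only [ne_comm] using h⟩
  loopless := ⟨fun α h => by
    obtain ⟨v, hv, -⟩ := h
    exact hv rfl⟩

/-! ### Recolouring strategies -/

section Upper

variable {p q k : ℕ}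

/-! Upper bounds come from averaging the costs of explicit strategies. If the left side has a colour
in common before and after, passing through it costs at most `2p + q`. Otherwise let C and D be its
disjoint initial and final palettes and R the remaining colours. The left side may pass through some
e in R (`edist_via_unused_le`), collapse to some c in C and jump to some d in D
(`edist_via_pair_le`), or move directly to some d in D (`edist_via_target_le`). Over a whole family
of M strategies, a right vertex makes at most M + 1 moves in total (`sum_unusedCost_le`). The family
R ∪ C×D saves `k * p` against `3p` left moves per strategy, with `k - 1 ≤ M ≤ k ^ 2 / 4`; the family
R ∪ D saves `p` against `2p`, with `M ≥ k / 2`.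

For lower bounds, split the colours into l low and h high ones, and let the left side go from low to
high and the right side from high to low. A recolouring walk determines a set G of pairs (c, d) such
that the right side is off d at some time and off c at the same or a later time. A right vertex
going from d to c with (c, d) in G needs two moves, while every left vertex must cross at a pair in
G and pays for each end that differs from its own (`exists_staircase`). Three choices of endpoints
make every G expensive: a monochromatic left side with `l = 1` for large q, a balanced one with
right multiplicities additive in row and column for the middle range, and one spread cyclically over
the pairs for small q. The last rests on a sumset estimate in `ZMod h`.

The corrections `g₁` and `g₂` are the gaps between these bounds. -/

/-- The colouring of `K_{p,q}` with prescribed restrictions to the two sides. -/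
def bicolouring (f : Fin p → Fin k) (g : Fin q → Fin k) (h : ∀ i j, f i ≠ g j) :
    (completeBipartiteGraph (Fin p) (Fin q)).Coloring (Fin k) :=
  SimpleGraph.Coloring.mk (Sum.elim f g) (by
    rintro (i | i) (j | j) hij
    · simp at hij
    · exact h i j
    · exact (h j i).symm
    · simp at hij)

@[simp] lemma bicolouring_inl (f : Fin p → Fin k) (g : Fin q → Fin k) (h : ∀ i j, f i ≠ g j)
    (i : Fin p) : bicolouring f g h (Sum.inl i) = f i := rfl

@[simp] lemma bicolouring_inr (f : Fin p → Fin k) (g : Fin q → Fin k) (h : ∀ i j, f i ≠ g j)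
    (j : Fin q) : bicolouring f g h (Sum.inr j) = g j := rfl

lemma coloring_disjoint (α : (completeBipartiteGraph (Fin p) (Fin q)).Coloring (Fin k))
    (i : Fin p) (j : Fin q) : α (Sum.inl i) ≠ α (Sum.inr j) :=
  α.valid (by simp)

lemma eq_bicolouring (α : (completeBipartiteGraph (Fin p) (Fin q)).Coloring (Fin k)) :
    α = bicolouring (fun i => α (Sum.inl i)) (fun j => α (Sum.inr j)) (coloring_disjoint α) := by
  apply RelHom.ext
  rintro (i | j) <;> rfl

variable (p q k) in
/-- The recolouring graph of `K_{p,q}`. -/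
abbrev bipartiteRecolouringGraph :=
  recolouringGraph (completeBipartiteGraph (Fin p) (Fin q)) k

lemma edist_right_le (f : Fin p → Fin k) (g g' : Fin q → Fin k) (h : ∀ i j, f i ≠ g j)
    (h' : ∀ i j, f i ≠ g' j) :
    (bipartiteRecolouringGraph p q k).edist (bicolouring f g h) (bicolouring f g' h') ≤
      (hammingDist g g' : ℕ) := by
  induction hn : hammingDist g g' generalizing g with
  | zero =>
    have : g = g' := by simpa using hn
    subst this
    simp
  | succ n ih =>
    have hne : g ≠ g' := by
      rintro rfl
      simp at hn
    obtain ⟨j, hj⟩ := Function.ne_iff.mp hne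
    set g₁ := Function.update g j (g' j) with hg₁
    have h₁ : ∀ i l, f i ≠ g₁ l := by
      intro i l
      by_cases hl : l = j
      · subst hl
        simpa [hg₁] using h' i l
      · simpa [hg₁, hl] using h i l
    have hd : hammingDist g₁ g' = n := by
      have hs : (Finset.univ.filter fun l => g l ≠ g' l) =
          insert j (Finset.univ.filter fun l => g₁ l ≠ g' l) := by
        ext l
        by_cases hl : l = j
        · subst hl; simp [hj]
        · simp [hg₁, hl]
      have hs' : j ∉ (Finset.univ.filter fun l => g₁ l ≠ g' l) := by simp [hg₁]
      have := Finset.card_insert_of_notMem hs'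
      rw [← hs] at this
      unfold hammingDist at hn ⊢
      omega
    have hadj : (bipartiteRecolouringGraph p q k).Adj (bicolouring f g h)
        (bicolouring f g₁ h₁) := by
      refine ⟨Sum.inr j, by simpa [hg₁] using hj, ?_⟩
      rintro (i | l) hl
      · simp at hl
      · by_contra hne
        have : l ≠ j := fun h => hne (by rw [h])
        simp [hg₁, this] at hl
    calc _ ≤ (bipartiteRecolouringGraph p q k).edist (bicolouring f g h) (bicolouring f g₁ h₁) +
        (bipartiteRecolouringGraph p q k).edist (bicolouring f g₁ h₁) (bicolouring f g' h') :=
          SimpleGraph.edist_triangle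
      _ ≤ 1 + (n : ℕ) := by
          gcongr
          · exact (SimpleGraph.edist_eq_one_iff_adj.mpr hadj).le
          · exact ih g₁ h₁ hd
      _ = _ := by push_cast; ring

lemma edist_left_le (f f' : Fin p → Fin k) (g : Fin q → Fin k) (h : ∀ i j, f i ≠ g j)
    (h' : ∀ i j, f' i ≠ g j) :
    (bipartiteRecolouringGraph p q k).edist (bicolouring f g h) (bicolouring f' g h') ≤
      (hammingDist f f' : ℕ) := by
  induction hn : hammingDist f f' generalizing f with
  | zero =>
    have : f = f' := by simpa using hn
    subst this
    simp
  | succ n ih =>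
    have hne : f ≠ f' := by
      rintro rfl
      simp at hn
    obtain ⟨j, hj⟩ := Function.ne_iff.mp hne
    set f₁ := Function.update f j (f' j) with hf₁
    have h₁ : ∀ i l, f₁ i ≠ g l := by
      intro i l
      by_cases hl : i = j
      · subst hl
        simpa [hf₁] using h' i l
      · simpa [hf₁, hl] using h i l
    have hd : hammingDist f₁ f' = n := by
      have hs : (Finset.univ.filter fun l => f l ≠ f' l) =
          insert j (Finset.univ.filter fun l => f₁ l ≠ f' l) := by
        ext l
        by_cases hl : l = j
        · subst hl; simp [hj]
        · simp [hf₁, hl]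
      have hs' : j ∉ (Finset.univ.filter fun l => f₁ l ≠ f' l) := by simp [hf₁]
      have := Finset.card_insert_of_notMem hs'
      rw [← hs] at this
      unfold hammingDist at hn ⊢
      omega
    have hadj : (bipartiteRecolouringGraph p q k).Adj (bicolouring f g h)
        (bicolouring f₁ g h₁) := by
      refine ⟨Sum.inl j, by simpa [hf₁] using hj, ?_⟩
      rintro (i | l) hl
      · by_contra hne
        have : i ≠ j := fun h => hne (by rw [h])
        simp [hf₁, this] at hl
      · simp at hl
    calc _ ≤ (bipartiteRecolouringGraph p q k).edist (bicolouring f g h) (bicolouring f₁ g h₁) +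
        (bipartiteRecolouringGraph p q k).edist (bicolouring f₁ g h₁) (bicolouring f' g h') :=
          SimpleGraph.edist_triangle
      _ ≤ 1 + (n : ℕ) := by
          gcongr
          · exact (SimpleGraph.edist_eq_one_iff_adj.mpr hadj).le
          · exact ih f₁ h₁ hd
      _ = _ := by push_cast; ring

/-- The left side is moved to the single colour `e` and from there to its final colours. -/
lemma edist_via_constant_le (f f' : Fin p → Fin k) (g g₁ g₂ g' : Fin q → Fin k) (e : Fin k)
    (h : ∀ i j, f i ≠ g j) (h' : ∀ i j, f' i ≠ g' j) (h₁ : ∀ i j, f i ≠ g₁ j)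
    (h₂ : ∀ i j, f' i ≠ g₂ j) (he₁ : ∀ j, e ≠ g₁ j) (he₂ : ∀ j, e ≠ g₂ j) :
    (bipartiteRecolouringGraph p q k).edist (bicolouring f g h) (bicolouring f' g' h') ≤
      (hammingDist f (fun _ => e) + hammingDist (fun _ => e) f' +
        (hammingDist g g₁ + hammingDist g₁ g₂ + hammingDist g₂ g') : ℕ) := by
  have e1 := edist_right_le f g g₁ h h₁
  have e2 := edist_left_le f (fun _ => e) g₁ h₁ (fun _ => he₁)
  have e3 := edist_right_le (fun _ : Fin p => e) g₁ g₂ (fun _ => he₁) (fun _ => he₂)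
  have e4 := edist_left_le (fun _ => e) f' g₂ (fun _ => he₂) h₂
  have e5 := edist_right_le f' g₂ g' h₂ h'
  refine (SimpleGraph.edist_triangle.trans (add_le_add e1 (SimpleGraph.edist_triangle.trans
    (add_le_add e2 (SimpleGraph.edist_triangle.trans (add_le_add e3
    (SimpleGraph.edist_triangle.trans (add_le_add e4 e5)))))))).trans (le_of_eq ?_)
  push_cast
  ring

lemma hammingDist_eq_sum {n : ℕ} (g g' : Fin n → Fin k) :
    hammingDist g g' = ∑ j, if g j ≠ g' j then 1 else 0 := by
  rw [hammingDist, Finset.card_filter]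

/-- The left side is moved directly to the colour `d`, while the vertices of the right side that
cannot take their final colours yet wait at `w`. -/
lemma edist_via_target_le (f f' : Fin p → Fin k) (g g' : Fin q → Fin k)
    (h : ∀ i j, f i ≠ g j) (h' : ∀ i j, f' i ≠ g' j) (d w : Fin k) (hd : ∃ i, f' i = d)
    (hwd : w ≠ d) (hw : ∀ i, f i ≠ w) :
    (bipartiteRecolouringGraph p q k).edist (bicolouring f g h) (bicolouring f' g' h') ≤
      (p + hammingDist (fun _ => d) f' + ∑ j, ((if g j ≠ g' j then 1 else 0) +
        if g j = d ∧ g' j ∈ Set.range f then 1 else 0) : ℕ) := by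
  classical
  have hd' : ∀ j, g' j ≠ d := by
    obtain ⟨i, rfl⟩ := hd
    exact fun j => (h' i j).symm
  -- Only right vertices at `d` must make way, and only those whose target is still used by the left
  -- side pay an extra move.
  let g₁ : Fin q → Fin k := fun j =>
    if g j = d then (if g' j ∈ Set.range f then w else g' j) else g j
  have h₁ : ∀ i j, f i ≠ g₁ j := by
    intro i j
    simp only [g₁]
    split_ifs with a b
    · exact hw i
    · exact fun hi => b ⟨i, hi⟩
    · exact h i j
  have hd₁ : ∀ j, d ≠ g₁ j := by
    intro j
    simp only [g₁]
    split_ifs with a b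
    · exact hwd.symm
    · exact (hd' j).symm
    · exact fun h => a h.symm
  refine (edist_via_constant_le f f' g g₁ g' g' d h h' h₁ h' hd₁
    (fun j => (hd' j).symm)).trans ?_
  refine Nat.cast_le.mpr ?_
  have hp : hammingDist f (fun _ => d) ≤ p := by
    simpa using hammingDist_le_card_fintype (x := f) (y := fun _ => d)
  have hq : hammingDist g g₁ + hammingDist g₁ g' + hammingDist g' g' ≤
      ∑ j, ((if g j ≠ g' j then 1 else 0) +
        if g j = d ∧ g' j ∈ Set.range f then 1 else 0) := by
    rw [hammingDist_self, add_zero, hammingDist_eq_sum, hammingDist_eq_sum,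
      ← Finset.sum_add_distrib]
    refine Finset.sum_le_sum fun j _ => ?_
    have := hd' j
    simp only [g₁]
    by_cases a : g j = d
    · have : g j ≠ g' j := by rw [a]; exact this.symm
      by_cases b : g' j ∈ Set.range f
      · simp only [a, b, if_true, and_self]
        split_ifs <;> simp_all
      · simp only [a, b, if_true, if_false]
        split_ifs <;> simp_all
    · simp [a]
  omega

/-- The left side is first collapsed to the colour `c`, then moved to `d`. -/
lemma edist_via_pair_le (hk : 3 ≤ k) (f f' : Fin p → Fin k) (g g' : Fin q → Fin k)
    (h : ∀ i j, f i ≠ g j) (h' : ∀ i j, f' i ≠ g' j) (c d : Fin k) (hc : ∃ i, f i = c)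
    (hd : ∃ i, f' i = d) :
    (bipartiteRecolouringGraph p q k).edist (bicolouring f g h) (bicolouring f' g' h') ≤
      (hammingDist f (fun _ => c) + p + hammingDist (fun _ => d) f' +
        ∑ j, ((if g j ≠ g' j then 1 else 0) +
        if g j = d ∧ g' j = c then 1 else 0) : ℕ) := by
  classical
  have hcg : ∀ j, c ≠ g j := by
    obtain ⟨i, rfl⟩ := hc
    exact h i
  obtain ⟨w, hw⟩ : ∃ w : Fin k, w ∉ ({c, d} : Finset (Fin k)) := by
    by_contra hcon
    push Not at hcon
    have := Finset.card_le_card (fun x _ => hcon x : (Finset.univ : Finset (Fin k)) ⊆ {c, d})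
    have h2 := Finset.card_le_two (a := c) (b := d)
    simp at this
    omega
  simp only [Finset.mem_insert, Finset.mem_singleton, not_or] at hw
  have e1 := edist_left_le f (fun _ => c) g h (fun _ => hcg)
  have e2 := edist_via_target_le (fun _ => c) f' g g' (fun _ => hcg) h' d w hd hw.2
    (fun _ => Ne.symm hw.1)
  refine (SimpleGraph.edist_triangle.trans (add_le_add e1 e2)).trans ?_
  rw [← Nat.cast_add]
  refine Nat.cast_le.mpr ?_
  have : ∀ j, (if g j = d ∧ g' j ∈ Set.range (fun _ : Fin p => c) then 1 else 0) ≤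
      if g j = d ∧ g' j = c then 1 else 0 := by
    intro j
    split_ifs with a b
    · simp
    · obtain ⟨x, y, hy⟩ := a
      exact absurd ⟨x, hy.symm⟩ b
    · simp
    · simp
  have := Finset.sum_le_sum fun j (_ : j ∈ (Finset.univ : Finset (Fin q))) =>
    add_le_add_right (this j) (if g j ≠ g' j then 1 else 0)
  omega

/-- The left side is moved through a colour `e` that it uses neither initially nor finally. -/
lemma edist_via_unused_le (f f' : Fin p → Fin k) (g g' : Fin q → Fin k)
    (h : ∀ i j, f i ≠ g j) (h' : ∀ i j, f' i ≠ g' j) (hff : ∀ i j, f i ≠ f' j) (hp : 0 < p)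
    (e : Fin k) (he : e ∉ Set.range f) (he' : e ∉ Set.range f') :
    (bipartiteRecolouringGraph p q k).edist (bicolouring f g h) (bicolouring f' g' h') ≤
      (2 * p + ∑ j, ((if g j ≠ g' j then 1 else 0) +
        (if g j = e ∧ g' j ∈ Set.range f then 1 else 0) +
        (if g' j = e ∧ g j ∈ Set.range f' then 1 else 0) +
        if g j = e ∧ g' j = e then 3 else 0) : ℕ) := by
  classical
  set c := f ⟨0, hp⟩ with hc
  set d := f' ⟨0, hp⟩ with hd
  have hcf : c ∈ Set.range f := ⟨_, rfl⟩
  have hdf : d ∈ Set.range f' := ⟨_, rfl⟩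
  have hce : e ≠ c := fun h => he (h ▸ hcf)
  have hde : e ≠ d := fun h => he' (h ▸ hdf)
  -- Before the left side reaches `e`, `d` is a safe waiting colour; once it has left its initial
  -- palette, `c` is. A vertex that both starts and ends at `e` goes `e`, `d`, `c`, `e`, whence the
  -- 3 in the cost.
  let g₁ : Fin q → Fin k := fun j =>
    if g j = e then (if g' j ∈ Set.range f ∨ g' j = e then d else g' j) else g j
  let g₂ : Fin q → Fin k := fun j =>
    if g' j = e then (if g₁ j ∈ Set.range f' then c else g₁ j) else g' j
  have h₁ : ∀ i j, f i ≠ g₁ j := by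
    intro i j
    simp only [g₁]
    split_ifs with a b
    · exact hff i _
    · exact fun hi => b (Or.inl ⟨i, hi⟩)
    · exact h i j
  have he₁ : ∀ j, e ≠ g₁ j := by
    intro j
    simp only [g₁]
    split_ifs with a b
    · exact hde
    · exact fun h => b (Or.inr h.symm)
    · exact fun h => a h.symm
  have h₂ : ∀ i j, f' i ≠ g₂ j := by
    intro i j
    simp only [g₂]
    split_ifs with a b
    · exact (hff _ i).symm
    · exact fun hi => b ⟨i, hi⟩
    · exact h' i j
  have he₂ : ∀ j, e ≠ g₂ j := by
    intro j
    simp only [g₂]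
    split_ifs with a b
    · exact hce
    · exact he₁ j
    · exact fun h => a h.symm
  refine (edist_via_constant_le f f' g g₁ g₂ g' e h h' h₁ h₂ he₁ he₂).trans ?_
  refine Nat.cast_le.mpr ?_
  have hp1 : hammingDist f (fun _ => e) ≤ p := by
    simpa using hammingDist_le_card_fintype (x := f) (y := fun _ => e)
  have hp2 : hammingDist (fun _ => e) f' ≤ p := by
    simpa using hammingDist_le_card_fintype (x := fun _ => e) (y := f')
  have hq : hammingDist g g₁ + hammingDist g₁ g₂ + hammingDist g₂ g' ≤
      ∑ j, ((if g j ≠ g' j then 1 else 0) +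
        (if g j = e ∧ g' j ∈ Set.range f then 1 else 0) +
        (if g' j = e ∧ g j ∈ Set.range f' then 1 else 0) +
        if g j = e ∧ g' j = e then 3 else 0) := by
    rw [hammingDist_eq_sum, hammingDist_eq_sum, hammingDist_eq_sum,
      ← Finset.sum_add_distrib, ← Finset.sum_add_distrib]
    refine Finset.sum_le_sum fun j _ => ?_
    by_cases a : g j = e
    · by_cases b : g' j = e
      · simp only [a, b, and_self, if_true]
        split_ifs <;> omega
      · have hne : g j ≠ g' j := by rw [a]; exact Ne.symm b
        have hg₂ : g₂ j = g' j := by simp [g₂, b]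
        by_cases m : g' j ∈ Set.range f
        · simp only [hg₂, a, m, and_self, if_true, ne_eq, not_true_eq_false, if_false]
          rw [a] at hne
          simp only [hne, not_false_iff, if_true]
          split_ifs <;> omega
        · have hg₁ : g₁ j = g' j := by simp only [g₁, a, m, b, or_self, if_true, if_false]
          simp only [hg₂, hg₁, ne_eq, not_true_eq_false, if_false]
          omega
    · have hg₁ : g₁ j = g j := by simp [g₁, a]
      by_cases b : g' j = e
      · have hne : g j ≠ g' j := by rw [b]; exact a
        by_cases m : g j ∈ Set.range f'
        · have : g j ≠ c := fun hh => h ⟨0, hp⟩ j hh.symm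
          simp only [hg₁, b, m, and_self, if_true, ne_eq, not_true_eq_false, if_false]
          rw [b] at hne
          simp only [hne, not_false_iff, if_true]
          split_ifs <;> omega
        · have hg₂ : g₂ j = g j := by simp only [g₂, b, if_true, hg₁, m, if_false]
          simp only [hg₂, hg₁, ne_eq, not_true_eq_false, if_false]
          omega
      · have hg₂ : g₂ j = g' j := by simp [g₂, b]
        simp only [hg₂, hg₁, ne_eq, not_true_eq_false, if_false]
        omega
  omega

end Upper

/-! ### Averaging over strategies -/

section Averaging

variable {p q k : ℕ}

lemma sum_hammingDist_const_image (f : Fin p → Fin k) :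
    ∑ c ∈ Finset.univ.image f, hammingDist f (fun _ => c) + p =
      (Finset.univ.image f).card * p := by
  have h1 : ∀ c : Fin k, hammingDist f (fun _ => c) +
      (Finset.univ.filter fun i => f i = c).card = p := by
    intro c
    have := Finset.card_filter_add_card_filter_not (s := (Finset.univ : Finset (Fin p)))
      (fun i => f i = c)
    simp only [Finset.card_univ, Fintype.card_fin] at this
    rw [hammingDist, add_comm]
    exact this
  have h2 : ∑ c ∈ Finset.univ.image f, (Finset.univ.filter fun i => f i = c).card = p := by
    rw [← Finset.card_eq_sum_card_image]
    simp
  calc _ = ∑ c ∈ Finset.univ.image f, hammingDist f (fun _ => c) +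
        ∑ c ∈ Finset.univ.image f, (Finset.univ.filter fun i => f i = c).card := by rw [h2]
    _ = ∑ c ∈ Finset.univ.image f, p := by
        rw [← Finset.sum_add_distrib]
        exact Finset.sum_congr rfl fun c _ => h1 c
    _ = _ := by simp

lemma sum_ite_eq_and {ι : Type*} [DecidableEq ι] (s : Finset ι) (a : ι) (P : Prop) [Decidable P]
    (x : ℕ) : (∑ e ∈ s, if a = e ∧ P then x else 0) = if a ∈ s ∧ P then x else 0 := by
  by_cases hP : P
  · simp [hP]
  · simp [hP]

/-- The number of moves that a vertex of the right side with initial colour `a` and final colour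
`b` makes when the left side passes through the colour `e`. -/
abbrev unusedCost (f f' : Fin p → Fin k) (e a b : Fin k) : ℕ :=
  open Classical in
  (if a ≠ b then 1 else 0) + (if a = e ∧ b ∈ Set.range f then 1 else 0) +
    (if b = e ∧ a ∈ Set.range f' then 1 else 0) + if a = e ∧ b = e then 3 else 0

/-- Here `n` counts the strategies other than those through unused colours, and `x` bounds what the
vertex pays in them. If `a ≠ b`, an extra move needs (a, b) in R×C, D×R or D×C; these are mutually
exclusive, and each occurs for one strategy only. If `a = b`, the total is at most 3, which is where
`hn` enters. -/
lemma sum_unusedCost_le (f f' : Fin p → Fin k) (hff : ∀ i j, f i ≠ f' j) (a b : Fin k)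
    (haf : a ∉ Set.range f) (hbf : b ∉ Set.range f') (n : ℕ)
    (hn : 2 ≤ (Finset.univ \ (Finset.univ.image f ∪ Finset.univ.image f')).card + n)
    (x : ℕ) (hx : x ≤ n * (if a ≠ b then 1 else 0) +
      if a ∈ Finset.univ.image f' ∧ b ∈ Finset.univ.image f then 1 else 0) :
    ∑ e ∈ Finset.univ \ (Finset.univ.image f ∪ Finset.univ.image f'), unusedCost f f' e a b + x ≤
      (Finset.univ \ (Finset.univ.image f ∪ Finset.univ.image f')).card + n + 1 := by
  classical
  set C := Finset.univ.image f with hC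
  set D := Finset.univ.image f' with hD
  set R := Finset.univ \ (C ∪ D) with hR
  have memC : ∀ x, x ∈ Set.range f ↔ x ∈ C := by simp [hC]
  have memD : ∀ x, x ∈ Set.range f' ↔ x ∈ D := by simp [hD]
  have memR : ∀ x, x ∈ R → x ∉ C ∧ x ∉ D := by
    intro x hx
    simpa [hR] using hx
  have hCD : ∀ x, x ∈ C → x ∉ D := by
    intro x hx hx'
    obtain ⟨i, -, rfl⟩ := Finset.mem_image.mp hx
    obtain ⟨j, -, hj⟩ := Finset.mem_image.mp hx'
    exact hff i j hj.symm
  rw [memC] at haf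
  rw [memD] at hbf
  simp only [unusedCost, memC, memD, Finset.sum_add_distrib, Finset.sum_const, smul_eq_mul,
    sum_ite_eq_and]
  by_cases hab : a = b
  · subst hab
    have h1 : (∑ e ∈ R, if a = e ∧ a = e then 3 else 0) ≤ 3 := by
      simp only [and_self, Finset.sum_ite_eq]
      split_ifs <;> omega
    simp [haf, hbf] at hx h1 ⊢
    omega
  · have h1 : (∑ e ∈ R, if a = e ∧ b = e then 3 else 0) = 0 := by
      refine Finset.sum_eq_zero fun e _ => ?_
      rw [if_neg]
      rintro ⟨rfl, h⟩
      exact hab h.symm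
    rw [h1]
    simp only [ne_eq, hab, not_false_eq_true, if_true, mul_one] at hx ⊢
    have ha := memR a
    have hb := memR b
    have hb' := hCD b
    by_cases a1 : a ∈ R <;> by_cases a2 : a ∈ D <;> by_cases b1 : b ∈ C <;> by_cases b2 : b ∈ R <;>
      simp_all <;> omega

lemma card_unused_add (f f' : Fin p → Fin k) (hff : ∀ i j, f i ≠ f' j) :
    (Finset.univ \ (Finset.univ.image f ∪ Finset.univ.image f')).card +
      (Finset.univ.image f).card + (Finset.univ.image f').card = k := by
  have h1 := Finset.card_sdiff_add_card_eq_card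
    (Finset.subset_univ (Finset.univ.image f ∪ Finset.univ.image f'))
  have h2 : Disjoint (Finset.univ.image f) (Finset.univ.image f') := by
    rw [Finset.disjoint_left]
    intro x hx hx'
    obtain ⟨i, -, rfl⟩ := Finset.mem_image.mp hx
    obtain ⟨j, -, hj⟩ := Finset.mem_image.mp hx'
    exact hff i j hj.symm
  rw [Finset.card_union_of_disjoint h2] at h1
  simp only [Finset.card_univ, Fintype.card_fin] at h1
  omega

lemma card_image_pos (f : Fin p → Fin k) (hp : 0 < p) : 0 < (Finset.univ.image f).card :=
  Finset.card_pos.mpr ⟨f ⟨0, hp⟩, by simp⟩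

lemma sum_sum_add {ι κ : Type*} (s : Finset ι) (t : Finset κ) (F : ι → ℕ) (G : κ → ℕ)
    (X : ι → κ → ℕ) (p : ℕ) : ∑ c ∈ s, ∑ d ∈ t, (F c + p + G d + X c d) =
      t.card * ∑ c ∈ s, F c + s.card * (t.card * p) + s.card * ∑ d ∈ t, G d +
        ∑ c ∈ s, ∑ d ∈ t, X c d := by
  simp only [Finset.sum_add_distrib, Finset.sum_const, smul_eq_mul, Finset.mul_sum]

/-- Averages over R ∪ C×D. The collapses to c and expansions from d save `(|C| + |D|) * p` in total,
the unused colours save `|R| * p`, and `|R| + |C| + |D| = k`. -/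
lemma exists_average_over_pairs (hk : 3 ≤ k) (hp : 0 < p) (f f' : Fin p → Fin k)
    (g g' : Fin q → Fin k) (h : ∀ i j, f i ≠ g j) (h' : ∀ i j, f' i ≠ g' j)
    (hff : ∀ i j, f i ≠ f' j) (m : ℕ)
    (hm : (m : ℕ∞) ≤
      (bipartiteRecolouringGraph p q k).edist (bicolouring f g h) (bicolouring f' g' h')) :
    ∃ M : ℕ, k ≤ M + 1 ∧ M ≤ k ^ 2 / 4 ∧ M * m + k * p ≤ M * (3 * p + q) + q := by
  classical
  have hcard := card_unused_add f f' hff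
  have hCpos := card_image_pos f hp
  have hDpos := card_image_pos f' hp
  have hsC := sum_hammingDist_const_image f
  have hsD := sum_hammingDist_const_image f'
  have hper := sum_unusedCost_le f f' hff
  have hR : ∀ e ∈ Finset.univ \ (Finset.univ.image f ∪ Finset.univ.image f'),
      m ≤ 2 * p + ∑ j, unusedCost f f' e (g j) (g' j) := by
    intro e he
    have he' : e ∉ Set.range f ∧ e ∉ Set.range f' := by simpa using he
    exact Nat.cast_le.mp (hm.trans
      (edist_via_unused_le f f' g g' h h' hff hp e he'.1 he'.2))
  have hP : ∀ c ∈ Finset.univ.image f, ∀ d ∈ Finset.univ.image f',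
      m ≤ hammingDist f (fun _ => c) + p + hammingDist f' (fun _ => d) +
        ∑ j, ((if g j ≠ g' j then 1 else 0) + if g j = d ∧ g' j = c then 1 else 0) := by
    intro c hc d hd
    rw [hammingDist_comm f']
    exact Nat.cast_le.mp (hm.trans (edist_via_pair_le hk f f' g g' h h' c d (by simpa using hc)
      (by simpa using hd)))
  set C := Finset.univ.image f with hC
  set D := Finset.univ.image f' with hD
  set R := Finset.univ \ (C ∪ D) with hRdef
  have s1 := Finset.sum_le_sum hR
  have s2 := Finset.sum_le_sum fun c hc => Finset.sum_le_sum (hP c hc)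
  have hj : ∀ j, ∑ e ∈ R, unusedCost f f' e (g j) (g' j) + ∑ c ∈ C, ∑ d ∈ D,
      ((if g j ≠ g' j then 1 else 0) + if g j = d ∧ g' j = c then 1 else 0) ≤
        R.card + C.card * D.card + 1 := by
    intro j
    refine hper (g j) (g' j) ?_ ?_ _ ?_ _ (le_of_eq ?_)
    · rintro ⟨i, hi⟩
      exact h i j hi
    · rintro ⟨i, hi⟩
      exact h' i j hi
    · nlinarith
    · simp only [Finset.sum_add_distrib, sum_ite_eq_and, Finset.sum_const, smul_eq_mul]
      have : ∀ c, (g j ∈ D ∧ g' j = c) ↔ (g' j = c ∧ g j ∈ D) := fun c => and_comm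
      simp only [this, sum_ite_eq_and, and_comm]
      ring
  have s3 := Finset.sum_le_sum fun j (_ : j ∈ Finset.univ) => hj j
  rw [Finset.sum_add_distrib, Finset.sum_comm] at s3
  have s4 : ∑ j : Fin q, ∑ c ∈ C, ∑ d ∈ D,
      ((if g j ≠ g' j then 1 else 0) + if g j = d ∧ g' j = c then 1 else 0) =
      ∑ c ∈ C, ∑ d ∈ D, ∑ j : Fin q,
      ((if g j ≠ g' j then 1 else 0) + if g j = d ∧ g' j = c then 1 else 0) := by
    rw [Finset.sum_comm]
    exact Finset.sum_congr rfl fun c _ => Finset.sum_comm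
  rw [s4] at s3
  simp only [Finset.sum_add_distrib (f := fun _ => 2 * p), Finset.sum_const, smul_eq_mul,
    Finset.card_univ, Fintype.card_fin] at s1 s2 s3
  rw [sum_sum_add] at s2
  have e1 : D.card * (∑ c ∈ C, hammingDist f fun _ => c) + D.card * p =
      D.card * (C.card * p) := by rw [← hsC]; ring
  have e2 : C.card * (∑ d ∈ D, hammingDist f' fun _ => d) + C.card * p =
      C.card * (D.card * p) := by rw [← hsD]; ring
  refine ⟨R.card + C.card * D.card, by nlinarith, ?_, ?_⟩
  · have e3 : k ^ 2 = (R.card + C.card + D.card) ^ 2 := by rw [hcard]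
    rw [Nat.le_div_iff_mul_le (by norm_num), e3]
    have := sq_nonneg ((C.card : ℤ) - D.card)
    zify at hCpos hDpos ⊢
    nlinarith
  · have e3 : k * p = (R.card + C.card + D.card) * p := by rw [hcard]
    rw [e3]
    linarith

/-- Averages over R ∪ D. Having `|C| ≤ |D|` gives `k ≤ 2 * (|R| + |D|)` and leaves a waiting colour
outside `C ∪ {d}`; in the opposite case the walk is reversed. -/
lemma exists_average_over_targets_of_card_le (hk : 3 ≤ k) (hp : 0 < p) (f f' : Fin p → Fin k)
    (g g' : Fin q → Fin k) (h : ∀ i j, f i ≠ g j) (h' : ∀ i j, f' i ≠ g' j)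
    (hff : ∀ i j, f i ≠ f' j)
    (hcd : (Finset.univ.image f).card ≤ (Finset.univ.image f').card) (m : ℕ)
    (hm : (m : ℕ∞) ≤
      (bipartiteRecolouringGraph p q k).edist (bicolouring f g h) (bicolouring f' g' h')) :
    ∃ M : ℕ, k ≤ 2 * M ∧ M * m + p ≤ M * (2 * p + q) + q := by
  classical
  have hcard := card_unused_add f f' hff
  have hCpos := card_image_pos f hp
  have hDpos := card_image_pos f' hp
  have hsD := sum_hammingDist_const_image f'
  have hper := sum_unusedCost_le f f' hff
  have hR : ∀ e ∈ Finset.univ \ (Finset.univ.image f ∪ Finset.univ.image f'),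
      m ≤ 2 * p + ∑ j, unusedCost f f' e (g j) (g' j) := by
    intro e he
    have he' : e ∉ Set.range f ∧ e ∉ Set.range f' := by simpa using he
    exact Nat.cast_le.mp (hm.trans
      (edist_via_unused_le f f' g g' h h' hff hp e he'.1 he'.2))
  have hP : ∀ d ∈ Finset.univ.image f',
      m ≤ p + hammingDist f' (fun _ => d) +
        ∑ j, ((if g j ≠ g' j then 1 else 0) +
          if g j = d ∧ g' j ∈ Finset.univ.image f then 1 else 0) := by
    intro d hd
    obtain ⟨w, hw⟩ : ∃ w : Fin k, w ∉ insert d (Finset.univ.image f) := by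
      by_contra hcon
      push Not at hcon
      have h1 := Finset.card_le_card (fun x _ => hcon x : Finset.univ ⊆ _)
      have h2 := Finset.card_insert_le d (Finset.univ.image f)
      simp only [Finset.card_univ, Fintype.card_fin] at h1
      omega
    simp only [Finset.mem_insert, Finset.mem_image, Finset.mem_univ, true_and, not_or,
      not_exists] at hw
    have := Nat.cast_le.mp (hm.trans (edist_via_target_le f f' g g' h h' d w (by simpa using hd)
      hw.1 hw.2))
    rw [hammingDist_comm f']
    simpa using this
  set C := Finset.univ.image f with hC
  set D := Finset.univ.image f' with hD
  set R := Finset.univ \ (C ∪ D) with hRdef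
  have s1 := Finset.sum_le_sum hR
  have s2 := Finset.sum_le_sum hP
  have hj : ∀ j, ∑ e ∈ R, unusedCost f f' e (g j) (g' j) + ∑ d ∈ D,
      ((if g j ≠ g' j then 1 else 0) + if g j = d ∧ g' j ∈ C then 1 else 0) ≤
        R.card + D.card + 1 := by
    intro j
    refine hper (g j) (g' j) ?_ ?_ _ ?_ _ (le_of_eq ?_)
    · rintro ⟨i, hi⟩
      exact h i j hi
    · rintro ⟨i, hi⟩
      exact h' i j hi
    · omega
    · simp only [Finset.sum_add_distrib, sum_ite_eq_and, Finset.sum_const, smul_eq_mul]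
  have s3 := Finset.sum_le_sum fun j (_ : j ∈ Finset.univ) => hj j
  rw [Finset.sum_add_distrib, Finset.sum_comm, Finset.sum_comm (t := D)] at s3
  rw [Finset.sum_add_distrib] at s1 s2
  rw [Finset.sum_add_distrib (f := fun _ => p)] at s2
  simp only [Finset.sum_const, smul_eq_mul, Finset.card_univ, Fintype.card_fin] at s1 s2 s3
  refine ⟨R.card + D.card, by omega, ?_⟩
  nlinarith

lemma exists_average_over_targets (hk : 3 ≤ k) (hp : 0 < p) (f f' : Fin p → Fin k)
    (g g' : Fin q → Fin k) (h : ∀ i j, f i ≠ g j) (h' : ∀ i j, f' i ≠ g' j)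
    (hff : ∀ i j, f i ≠ f' j) (m : ℕ)
    (hm : (m : ℕ∞) ≤
      (bipartiteRecolouringGraph p q k).edist (bicolouring f g h) (bicolouring f' g' h')) :
    ∃ M : ℕ, k ≤ 2 * M ∧ M * m + p ≤ M * (2 * p + q) + q := by
  rcases le_total (Finset.univ.image f).card (Finset.univ.image f').card with hle | hle
  · exact exists_average_over_targets_of_card_le hk hp f f' g g' h h' hff hle m hm
  · exact exists_average_over_targets_of_card_le hk hp f' f g' g h' h
      (fun i j => (hff j i).symm) hle m (by rwa [SimpleGraph.edist_comm])

lemma edist_le_of_common_colour (f f' : Fin p → Fin k) (g g' : Fin q → Fin k)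
    (h : ∀ i j, f i ≠ g j) (h' : ∀ i j, f' i ≠ g' j) (hff : ∃ i j, f i = f' j) :
    (bipartiteRecolouringGraph p q k).edist (bicolouring f g h) (bicolouring f' g' h') ≤
      (2 * p + q : ℕ) := by
  obtain ⟨a, b, hab⟩ := hff
  refine (edist_via_constant_le f f' g g g' g' (f a) h h' h h' (h a)
    (fun j => hab ▸ h' b j)).trans (Nat.cast_le.mpr ?_)
  have h1 : hammingDist f (fun _ => f a) ≤ p := by
    simpa using hammingDist_le_card_fintype (x := f) (y := fun _ => f a)
  have h2 : hammingDist (fun _ => f a) f' ≤ p := by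
    simpa using hammingDist_le_card_fintype (x := fun _ => f a) (y := f')
  have h3 : hammingDist g g' ≤ q := by
    simpa using hammingDist_le_card_fintype (x := g) (y := g')
  simp only [hammingDist_self]
  omega

lemma recolouring_edist_ne_top (hk : 3 ≤ k) (hp : 0 < p)
    (α β : (completeBipartiteGraph (Fin p) (Fin q)).Coloring (Fin k)) :
    (bipartiteRecolouringGraph p q k).edist α β ≠ ⊤ := by
  rw [eq_bicolouring α, eq_bicolouring β]
  refine ne_top_of_le_ne_top ?_
    (edist_via_pair_le hk _ _ _ _ _ _ _ _ ⟨⟨0, hp⟩, rfl⟩ ⟨⟨0, hp⟩, rfl⟩)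
  exact ENat.natCast_ne_top _

theorem edist_cases (hk : 3 ≤ k) (hp : 0 < p)
    (α β : (completeBipartiteGraph (Fin p) (Fin q)).Coloring (Fin k)) :
    ∃ m : ℕ, (bipartiteRecolouringGraph p q k).edist α β = m ∧ (m ≤ 2 * p + q ∨
      (∃ M : ℕ, k ≤ M + 1 ∧ M ≤ k ^ 2 / 4 ∧ M * m + k * p ≤ M * (3 * p + q) + q) ∧
      ∃ M : ℕ, k ≤ 2 * M ∧ M * m + p ≤ M * (2 * p + q) + q) := by
  obtain ⟨m, hm⟩ := ENat.ne_top_iff_exists.mp (recolouring_edist_ne_top hk hp α β)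
  refine ⟨m, hm.symm, ?_⟩
  rw [eq_bicolouring α, eq_bicolouring β] at hm
  by_cases hff : ∃ i j, α (Sum.inl i) = β (Sum.inl j)
  · left
    exact Nat.cast_le.mp (hm.le.trans (edist_le_of_common_colour _ _ _ _ _ _ hff))
  · right
    push Not at hff
    exact ⟨exists_average_over_pairs hk hp _ _ _ _ _ _ hff m hm.le,
      exists_average_over_targets hk hp _ _ _ _ _ _ hff m hm.le⟩

/-- The recolouring graph is connected, and some pair of colourings attains its diameter. -/
lemma diam_attained (hk : 3 ≤ k) (hp : 0 < p) :
    (bipartiteRecolouringGraph p q k).ediam ≠ ⊤ ∧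
    ∃ α β, (bipartiteRecolouringGraph p q k).edist α β =
      (bipartiteRecolouringGraph p q k).diam := by
  have : Nonempty ((completeBipartiteGraph (Fin p) (Fin q)).Coloring (Fin k)) :=
    ⟨bicolouring (fun _ => ⟨0, by omega⟩) (fun _ => ⟨1, by omega⟩) (by simp)⟩
  have hfin : Finite ((completeBipartiteGraph (Fin p) (Fin q)).Coloring (Fin k)) :=
    Finite.of_injective (fun α => (α : Fin p ⊕ Fin q → Fin k)) DFunLike.coe_injective
  obtain ⟨α, β, h⟩ := (bipartiteRecolouringGraph p q k).exists_edist_eq_ediam_of_finite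
  have htop := h ▸ recolouring_edist_ne_top hk hp α β
  refine ⟨htop, α, β, ?_⟩
  rw [h, SimpleGraph.diam, ENat.natCast_toNat htop]

end Averaging

/-! ### Moves forced by a recolouring walk -/

section Trajectories

/-- The number of times in `[a, b)` at which the sequence `x` changes its value. -/
def changes {K : Type*} [DecidableEq K] (x : ℕ → K) (a b : ℕ) : ℕ :=
  ((Finset.Ico a b).filter fun t => x t ≠ x (t + 1)).card

section
variable {K : Type*} [DecidableEq K] (x : ℕ → K)

lemma changes_add {a b c : ℕ} (hab : a ≤ b) (hbc : b ≤ c) :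
    changes x a b + changes x b c = changes x a c := by
  simp only [changes, Finset.card_filter]
  exact Finset.sum_Ico_consecutive _ hab hbc

lemma changes_pos {a b : ℕ} (hab : a ≤ b) (hx : x a ≠ x b) : 1 ≤ changes x a b := by
  by_contra hcon
  have h0 : ∀ t ∈ Finset.Ico a b, x t = x (t + 1) := by
    have : changes x a b = 0 := by omega
    rw [changes, Finset.card_eq_zero, Finset.filter_eq_empty_iff] at this
    exact fun t ht => not_not.mp (this ht)
  have h1 : ∀ m, a + m ≤ b → x a = x (a + m) := by
    intro m
    induction m with
    | zero => simp
    | succ m ih =>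
      intro hm
      rw [ih (by omega), h0 (a + m) (by simp; omega)]
      rfl
  exact hx (by simpa [Nat.add_sub_cancel' hab] using h1 (b - a) (by omega))

lemma ite_ne_le_changes {a b : ℕ} (hab : a ≤ b) :
    (if x a ≠ x b then 1 else 0) ≤ changes x a b := by
  split_ifs with h
  · exact changes_pos x hab h
  · simp

end

/-- The number of superfluous moves forced on a vertex of the left side of type `y`, when `G` is
the set of pairs of colours whose first colour is available to the left side not before the
second one is; `z` is the extreme pair. -/
abbrev leftExcess {ι κ : Type*} [DecidableEq ι] [DecidableEq κ] (G : Finset (ι × κ))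
    (z y : ι × κ) : ℕ :=
  max ((if (y.1, z.2) ∈ G then 0 else 1) + (if (z.1, y.2) ∈ G then 0 else 1))
    (if y ∈ G then 0 else 1)

variable {l h p q : ℕ}

/-- When a left vertex jumps from low c to high d, the right side is off both colours, so (c, d)
lies in G. The extreme pair `z` joins the low colour that is free latest to the high colour that is
free earliest, so replacing either coordinate of a pair of G by that of `z` stays in G. -/
theorem exists_staircase_of_trajectory (hp : 0 < p) (n : ℕ) (X : ℕ → Fin p → Fin l ⊕ Fin h)
    (Y : ℕ → Fin q → Fin l ⊕ Fin h) (hXY : ∀ t i j, X t i ≠ Y t j)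
    (hstep : ∀ t < n, ∀ i, X t i ≠ X (t + 1) i → Y t = Y (t + 1))
    (φ : Fin p → Fin l × Fin h) (ψ : Fin q → Fin l × Fin h)
    (hX0 : ∀ i, X 0 i = Sum.inl (φ i).1) (hXn : ∀ i, X n i = Sum.inr (φ i).2)
    (hY0 : ∀ j, Y 0 j = Sum.inr (ψ j).2) (hYn : ∀ j, Y n j = Sum.inl (ψ j).1) :
    ∃ G : Finset (Fin l × Fin h), ∃ z ∈ G, (∀ y ∈ G, (z.1, y.2) ∈ G ∧ (y.1, z.2) ∈ G) ∧
      (∀ i, 1 + leftExcess G z (φ i) ≤ changes (fun t => X t i) 0 n) ∧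
      ∀ j, (1 + if ψ j ∈ G then 1 else 0) ≤ changes (fun t => Y t j) 0 n := by
  classical
  let good : Fin l × Fin h → Prop := fun y => ∃ a b, a ≤ b ∧ b ≤ n ∧
    (∀ j, Y a j ≠ Sum.inr y.2) ∧ ∀ j, Y b j ≠ Sum.inl y.1
  let G : Finset (Fin l × Fin h) := Finset.univ.filter good
  have hG : ∀ y, y ∈ G ↔ good y := by simp [G]
  -- each vertex of the left side passes directly between the two colour classes
  have hcross : ∀ i, ∃ t < n, ∃ y, X t i = Sum.inl y.1 ∧ X (t + 1) i = Sum.inr y.2 ∧ y ∈ G := by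
    intro i
    have hex : ∃ t, (X t i).isRight := ⟨n, by simp [hXn]⟩
    have hspec := Nat.find_spec hex
    have hmin := fun m => Nat.find_min hex (m := m)
    have hle : Nat.find hex ≤ n := Nat.find_min' hex (by simp [hXn])
    generalize Nat.find hex = s at hspec hmin hle
    cases s with
    | zero => simp [hX0] at hspec
    | succ t =>
      have h1 := hmin t (by omega)
      obtain ⟨d, hd⟩ := Sum.isRight_iff.mp hspec
      obtain ⟨c, hc⟩ : ∃ c, X t i = Sum.inl c := Sum.isLeft_iff.mp (by simpa using h1)
      refine ⟨t, hle, (c, d), hc, hd, (hG _).mpr ⟨t, t, le_rfl, by omega, ?_, ?_⟩⟩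
      · intro j
        rw [hstep t hle i (by rw [hc, hd]; simp), ← hd]
        exact (hXY _ _ _).symm
      · intro j
        rw [← hc]
        exact (hXY _ _ _).symm
  obtain ⟨t₀, ht₀, y₀, -, -, hy₀⟩ := hcross ⟨0, hp⟩
  -- the extreme pair
  obtain ⟨d₁, a₁, ha₁, hd₁, hamin⟩ : ∃ d a, a ≤ n ∧ (∀ j, Y a j ≠ Sum.inr d) ∧
      ∀ d' : Fin h, ∀ a', (∀ j, Y a' j ≠ Sum.inr d') → a ≤ a' := by
    have hex : ∃ a, ∃ d : Fin h, ∀ j, Y a j ≠ Sum.inr d := ⟨n, y₀.2, by simp [hYn]⟩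
    obtain ⟨d, hd⟩ := Nat.find_spec hex
    exact ⟨d, Nat.find hex, Nat.find_min' hex ⟨y₀.2, by simp [hYn]⟩, hd,
      fun d' a' h' => Nat.find_min' hex ⟨d', h'⟩⟩
  obtain ⟨c₁, b₁, hb₁, hc₁, hbmax⟩ : ∃ c b, b ≤ n ∧ (∀ j, Y b j ≠ Sum.inl c) ∧
      ∀ c' : Fin l, ∀ b' ≤ n, (∀ j, Y b' j ≠ Sum.inl c') → b' ≤ b := by
    -- Minimising `m = n - b` picks the last time at which some low colour is free.
    have hex : ∃ m, ∃ b, b + m = n ∧ ∃ c : Fin l, ∀ j, Y b j ≠ Sum.inl c :=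
      ⟨n, 0, by simp, y₀.1, by simp [hY0]⟩
    obtain ⟨b, hb, c, hc⟩ := Nat.find_spec hex
    refine ⟨c, b, by omega, hc, fun c' b' hb' h' => ?_⟩
    have := Nat.find_min' hex (m := n - b') ⟨b', by omega, c', h'⟩
    omega
  have hab : a₁ ≤ b₁ := by
    obtain ⟨a, b, h1, h2, h3, h4⟩ := (hG _).mp hy₀
    have := hamin _ _ h3
    have := hbmax _ _ h2 h4
    omega
  have hcl : ∀ y ∈ G, (c₁, y.2) ∈ G ∧ (y.1, d₁) ∈ G := by
    intro y hy
    obtain ⟨a, b, h1, h2, h3, h4⟩ := (hG _).mp hy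
    have h5 := hamin _ _ h3
    have h6 := hbmax _ _ h2 h4
    exact ⟨(hG _).mpr ⟨a, b₁, by omega, hb₁, h3, hc₁⟩, (hG _).mpr ⟨a₁, b, by omega, h2, hd₁, h4⟩⟩
  refine ⟨G, (c₁, d₁), (hG _).mpr ⟨a₁, b₁, hab, hb₁, hd₁, hc₁⟩, hcl, fun i => ?_, fun j => ?_⟩
  · obtain ⟨t, ht, y, hy1, hy2, hy⟩ := hcross i
    have e1 := changes_add (fun t => X t i) (Nat.zero_le t) ht.le
    have e2 := changes_add (fun t => X t i) (Nat.le_add_right t 1) ht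
    have e3 : 1 ≤ changes (fun t => X t i) t (t + 1) :=
      changes_pos _ t.le_succ (by simp [hy1, hy2])
    have e4 := ite_ne_le_changes (fun t => X t i) (Nat.zero_le t)
    have e5 := ite_ne_le_changes (fun t => X t i) (show t + 1 ≤ n from ht)
    have key : leftExcess G (c₁, d₁) (φ i) ≤
        (if (φ i).1 ≠ y.1 then 1 else 0) + (if y.2 ≠ (φ i).2 then 1 else 0) := by
      have hc := hcl y hy
      by_cases h1 : (φ i).1 = y.1
      · by_cases h2 : (φ i).2 = y.2
        · have : φ i = y := Prod.ext h1 h2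
          simp [leftExcess, this, hy, hc]
        · rw [leftExcess, h1]
          simp only [hc.2, Ne.symm h2, ne_eq, not_true_eq_false, if_true, if_false, not_false_eq_true]
          split_ifs <;> simp
      · by_cases h2 : (φ i).2 = y.2
        · rw [leftExcess, h2]
          simp only [hc.1, h1, ne_eq, not_true_eq_false, if_true, if_false, not_false_eq_true]
          split_ifs <;> simp
        · rw [leftExcess]
          simp only [Ne.symm h2, h1, ne_eq, if_true, not_false_eq_true]
          split_ifs <;> simp
    simp only [hX0, hXn, hy1, hy2, ne_eq, Sum.inl.injEq, Sum.inr.injEq] at e4 e5 key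
    omega
  · have hne : Y 0 j ≠ Y n j := by simp [hY0, hYn]
    by_cases hj : ψ j ∈ G
    · obtain ⟨a, b, h1, h2, h3, h4⟩ := (hG _).mp hj
      have e1 := changes_add (fun t => Y t j) (Nat.zero_le a) (h1.trans h2)
      have e2 := changes_add (fun t => Y t j) h1 h2
      have e3 : 1 ≤ changes (fun t => Y t j) 0 a :=
        changes_pos _ (Nat.zero_le a) (by rw [hY0]; exact (h3 j).symm)
      have e4 : 1 ≤ changes (fun t => Y t j) b n :=
        changes_pos _ h2 (by rw [hYn]; exact h4 j)
      simp only [hj, if_true]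
      omega
    · simp only [hj, if_false]
      exact changes_pos _ (Nat.zero_le n) hne

lemma sum_changes_eq_length {V K : Type*} [Fintype V] [DecidableEq K] (n : ℕ) (x : ℕ → V → K)
    (hx : ∀ t < n, ∃! v, x t v ≠ x (t + 1) v) : ∑ v, changes (fun t => x t v) 0 n = n := by
  classical
  simp only [changes, Finset.card_filter]
  rw [Finset.sum_comm]
  have : ∀ t ∈ Finset.Ico 0 n, (∑ v, if x t v ≠ x (t + 1) v then 1 else 0) = 1 := by
    intro t ht
    obtain ⟨v, hv, huniq⟩ := hx t (by simpa using ht)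
    rw [← Finset.card_filter, Finset.card_eq_one]
    refine ⟨v, ?_⟩
    ext w
    simp only [Finset.mem_filter, Finset.mem_univ, true_and, Finset.mem_singleton]
    exact ⟨huniq w, fun hw => hw ▸ hv⟩
  rw [Finset.sum_congr rfl this]
  simp

/-- The colours of `Fin (l + h)` split into a first class of `l` and a second class of `h` colours;
the left side moves from the first class to the second as prescribed by `φ`, and the right side
moves from the second to the first as prescribed by `ψ`. -/
theorem exists_staircase (hp : 0 < p) (φ : Fin p → Fin l × Fin h) (ψ : Fin q → Fin l × Fin h)
    (m : ℕ) (hm : ∀ α β, (bipartiteRecolouringGraph p q (l + h)).edist α β ≤ m) :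
    ∃ G : Finset (Fin l × Fin h), ∃ z ∈ G, (∀ y ∈ G, (z.1, y.2) ∈ G ∧ (y.1, z.2) ∈ G) ∧
      p + q + ∑ i, leftExcess G z (φ i) + (∑ j, if ψ j ∈ G then 1 else 0) ≤ m := by
  classical
  let e := (finSumFinEquiv : Fin l ⊕ Fin h ≃ Fin (l + h))
  let α : (completeBipartiteGraph (Fin p) (Fin q)).Coloring (Fin (l + h)) :=
    bicolouring (fun i => e (Sum.inl (φ i).1)) (fun j => e (Sum.inr (ψ j).2))
      (fun _ _ h => by simpa using e.injective h)
  let β : (completeBipartiteGraph (Fin p) (Fin q)).Coloring (Fin (l + h)) :=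
    bicolouring (fun i => e (Sum.inr (φ i).2)) (fun j => e (Sum.inl (ψ j).1))
      (fun _ _ h => by simpa using e.injective h)
  have hle := hm α β
  have hreach := SimpleGraph.edist_ne_top_iff_reachable.mp
    (ne_top_of_le_ne_top (ENat.natCast_ne_top m) hle)
  obtain ⟨w, hw⟩ := hreach.exists_walk_length_eq_edist
  rw [← hw, Nat.cast_le] at hle
  let x : ℕ → Fin p ⊕ Fin q → Fin l ⊕ Fin h := fun t v => e.symm (w.getVert t v)
  have hx : ∀ t < w.length, ∃! v, x t v ≠ x (t + 1) v := by
    intro t ht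
    obtain ⟨v, hv, huniq⟩ := w.adj_getVert_succ ht
    exact ⟨v, by simpa [x] using hv, fun u hu => huniq u (by simpa [x] using hu)⟩
  have hx0 : ∀ v, x 0 v = e.symm (α v) := by simp [x]
  have hxn : ∀ v, x w.length v = e.symm (β v) := by simp [x]
  obtain ⟨G, z, hz, hcl, h1, h2⟩ := exists_staircase_of_trajectory hp w.length
    (fun t i => x t (Sum.inl i)) (fun t j => x t (Sum.inr j))
    (fun t i j h => coloring_disjoint (w.getVert t) i j (e.symm.injective h))
    (fun t ht i hi => by
      funext j
      by_contra hj
      have := (hx t ht).unique hi hj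
      simp at this)
    φ ψ (by simp [hx0, α]) (by simp [hxn, β]) (by simp [hx0, α]) (by simp [hxn, β])
  refine ⟨G, z, hz, hcl, le_trans ?_ hle⟩
  have hsum := sum_changes_eq_length w.length x hx
  rw [Fintype.sum_sum_type] at hsum
  have s1 := Finset.sum_le_sum fun i (_ : i ∈ Finset.univ) => h1 i
  have s2 := Finset.sum_le_sum fun j (_ : j ∈ Finset.univ) => h2 j
  rw [Finset.sum_add_distrib] at s1 s2
  simp only [Finset.sum_const, Finset.card_univ, Fintype.card_fin, smul_eq_mul, mul_one] at s1 s2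
  omega

end Trajectories

/-! ### Monochromatic and balanced extremal colourings -/

section Constructions

lemma exists_fun_with_large_fibres {ι : Type*} [Fintype ι] [DecidableEq ι] [Nonempty ι] {q : ℕ}
    (n : ι → ℕ) (hn : ∑ y, n y ≤ q) :
    ∃ ψ : Fin q → ι, ∀ G : Finset ι, ∑ y ∈ G, n y ≤ ∑ j, if ψ j ∈ G then 1 else 0 := by
  classical
  obtain ⟨e⟩ : Nonempty ((Σ y, Fin (n y)) ↪ Fin q) :=
    Function.Embedding.nonempty_of_card_le (by simpa using hn)
  refine ⟨Function.extend e Sigma.fst fun _ => Classical.arbitrary ι, fun G => ?_⟩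
  rw [← Finset.card_filter]
  calc ∑ y ∈ G, n y = (G.sigma fun y => (Finset.univ : Finset (Fin (n y)))).card := by simp
    _ = ((G.sigma fun y => (Finset.univ : Finset (Fin (n y)))).map e).card := by simp
    _ ≤ _ := by
      refine Finset.card_le_card fun j hj => ?_
      obtain ⟨s, hs, rfl⟩ := Finset.mem_map.mp hj
      simp only [Finset.mem_filter, Finset.mem_univ, true_and, e.injective.extend_apply]
      exact (Finset.mem_sigma.mp hs).1

/-- Of G only its part in the row and column of `z` is controlled; erasing `z.2` avoids counting the
centre of this cross twice. -/
lemma sum_cross_le {ι κ : Type*} [Fintype ι] [Fintype κ] [DecidableEq ι] [DecidableEq κ]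
    (F : ι × κ → ℕ) (G : Finset (ι × κ)) (z : ι × κ) :
    ∑ c ∈ Finset.univ.filter (fun c => (c, z.2) ∈ G), F (c, z.2) +
      ∑ d ∈ (Finset.univ.filter fun d => (z.1, d) ∈ G).erase z.2, F (z.1, d) ≤
        ∑ y ∈ G, F y := by
  have i1 : Function.Injective fun c : ι => (c, z.2) := fun a b h => (Prod.ext_iff.mp h).1
  have i2 : Function.Injective fun d : κ => (z.1, d) := fun a b h => (Prod.ext_iff.mp h).2
  rw [← Finset.sum_image (g := fun c : ι => (c, z.2)) (f := F) i1.injOn,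
    ← Finset.sum_image (g := fun d : κ => (z.1, d)) (f := F) i2.injOn, ← Finset.sum_union]
  · refine Finset.sum_le_sum_of_subset fun y hy => ?_
    simp only [Finset.mem_union, Finset.mem_image, Finset.mem_filter, Finset.mem_univ, true_and,
      Finset.mem_erase] at hy
    rcases hy with ⟨c, hc, rfl⟩ | ⟨d, hd, rfl⟩
    · exact hc
    · exact hd.2
  · rw [Finset.disjoint_left]
    intro y hy hy'
    simp only [Finset.mem_image, Finset.mem_erase] at hy hy'
    obtain ⟨c, -, rfl⟩ := hy
    obtain ⟨d, hd, hd'⟩ := hy'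
    exact hd.1 (Prod.ext_iff.mp hd').2

variable {p q l h : ℕ}

/-- Lower bound from a left side that is monochromatic before and after. -/
theorem le_of_monochromatic (hp : 0 < p) (hpq : p ≤ q) (hh : 0 < h) (m : ℕ)
    (hm : ∀ α β, (bipartiteRecolouringGraph p q (1 + h)).edist α β ≤ m) :
    2 * p + q + (q - p) / h ≤ m := by
  classical
  set x := (q - p) / h with hx
  let o : Fin 1 × Fin h := (0, ⟨0, hh⟩)
  have : Nonempty (Fin 1 × Fin h) := ⟨o⟩
  obtain ⟨ψ, hψ⟩ := exists_fun_with_large_fibres (q := q)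
    (fun y : Fin 1 × Fin h => x + if y = o then p else 0) (by
      simp only [Finset.sum_add_distrib, Finset.sum_const, Finset.sum_ite_eq', Finset.mem_univ,
        if_true, Finset.card_univ, Fintype.card_prod, Fintype.card_fin, smul_eq_mul, one_mul]
      have := Nat.mul_div_le (q - p) h
      rw [← hx] at this
      omega)
  obtain ⟨G, z, hz, -, hle⟩ := exists_staircase hp (fun _ => o) ψ m hm
  have h1 := hψ G
  simp only [Finset.sum_const, Finset.card_univ, Fintype.card_fin, smul_eq_mul] at hle
  -- Either the `p + x` right vertices of type `o` all pay, or every left vertex pays and so do the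
  -- `x` right vertices of type `z`.
  by_cases ho : o ∈ G
  · have h2 := Finset.single_le_sum (f := fun y : Fin 1 × Fin h => x + if y = o then p else 0)
      (fun _ _ => Nat.zero_le _) ho
    simp only [if_true] at h2
    omega
  · have h2 := Finset.single_le_sum (f := fun y : Fin 1 × Fin h => x + if y = o then p else 0)
      (fun _ _ => Nat.zero_le _) hz
    have h3 : 1 ≤ leftExcess G z o := le_max_of_le_right (by simp [ho])
    have h4 : p ≤ p * leftExcess G z o := Nat.le_mul_of_pos_right p h3
    omega

lemma div_le_card_filter_mod (p : ℕ) {l : ℕ} (c : ℕ) (hc : c < l) :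
    p / l ≤ (Finset.univ.filter fun i : Fin p => (i : ℕ) % l = c).card := by
  have hlt : ∀ t : Fin (p / l), c + l * t < p := by
    intro t
    have h1 := Nat.mul_div_le p l
    have h2 : l * (t + 1) ≤ l * (p / l) := Nat.mul_le_mul_left l t.2
    rw [Nat.mul_add] at h2
    omega
  have hinj : Function.Injective fun t : Fin (p / l) => (⟨c + l * t, hlt t⟩ : Fin p) := by
    intro t t' htt
    simp only [Fin.mk.injEq, add_right_inj] at htt
    exact Fin.ext (Nat.eq_of_mul_eq_mul_left (by omega) htt)
  calc p / l = (Finset.univ.image fun t : Fin (p / l) => (⟨c + l * t, hlt t⟩ : Fin p)).card := by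
        rw [Finset.card_image_of_injective _ hinj]; simp
    _ ≤ _ := by
      refine Finset.card_le_card fun i hi => ?_
      obtain ⟨t, -, rfl⟩ := Finset.mem_image.mp hi
      simp [Nat.add_mul_mod_self_left, Nat.mod_eq_of_lt hc]

lemma sum_not_mem_add_sum_card {ι : Type*} [Fintype ι] [DecidableEq ι] (f : Fin p → ι)
    (S : Finset ι) :
    (∑ i, if f i ∈ S then 0 else 1) + ∑ c ∈ S, (Finset.univ.filter fun i => f i = c).card = p := by
  have h1 : ∑ c ∈ S, (Finset.univ.filter fun i => f i = c).card =
      ∑ i, if f i ∈ S then 1 else 0 := by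
    simp only [Finset.card_filter]
    rw [Finset.sum_comm]
    simp
  rw [h1, ← Finset.sum_add_distrib]
  have : ∀ i, ((if f i ∈ S then 0 else 1) + if f i ∈ S then 1 else 0) = 1 := by
    intro i
    split_ifs <;> rfl
  simp [this]

lemma sum_card_add_sum_le_of_le {ι : Type*} [DecidableEq ι] (S : Finset ι) (z : ι) (hz : z ∈ S)
    (a n : ι → ℕ) (hn : ∀ c, a c ≤ n c + 1) :
    ∑ c ∈ S, a c + n z + 1 ≤ ∑ c ∈ S, n c + a z + S.card := by
  rw [← Finset.add_sum_erase S _ hz, ← Finset.add_sum_erase S n hz]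
  have h1 := Finset.sum_le_sum fun c (_ : c ∈ S.erase z) => hn c
  have h2 := Finset.card_erase_add_one hz
  simp only [Finset.sum_add_distrib, Finset.sum_const, smul_eq_mul, mul_one] at h1
  omega

/-- Lower bound from a left side that moves between two balanced colourings with complementary
colour classes. -/
theorem le_of_balanced (hl : 0 < l) (hlh : l ≤ h) (hhp : h ≤ p) (s : ℕ)
    (hs : h * s ≤ p + h - 1) (hsum : (l + h) * p ≤ q + l * h * s) (m : ℕ)
    (hm : ∀ α β, (bipartiteRecolouringGraph p q (l + h)).edist α β ≤ m) :
    3 * p + q + 2 ≤ m + s + l + h := by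
  classical
  have hh : 0 < h := by omega
  let φ : Fin p → Fin l × Fin h := fun i => (⟨i % l, Nat.mod_lt _ hl⟩, ⟨i % h, Nat.mod_lt _ hh⟩)
  let a : Fin l → ℕ := fun c => (Finset.univ.filter fun i => (φ i).1 = c).card
  let b : Fin h → ℕ := fun d => (Finset.univ.filter fun i => (φ i).2 = d).card
  have ha : ∀ c, p / l ≤ a c := fun c => by
    refine (div_le_card_filter_mod p c c.2).trans (le_of_eq ?_)
    simp [a, φ, Fin.ext_iff]
  have hb : ∀ d, p / h ≤ b d := fun d => by
    refine (div_le_card_filter_mod p d d.2).trans (le_of_eq ?_)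
    simp [b, φ, Fin.ext_iff]
  have hph : p / h ≤ p / l := Nat.div_le_div_left hlh hl
  have hs' : s ≤ p / h + 1 := by
    have h1 : s ≤ (p + h - 1) / h := (Nat.le_div_iff_mul_le hh).mpr (by rw [mul_comm]; exact hs)
    have h2 : (p + h - 1) / h ≤ (p + h) / h := Nat.div_le_div_right (by omega)
    rw [Nat.add_div_right _ hh] at h2
    omega
  have hone : 1 ≤ p / h := Nat.div_pos hhp hh
  -- With these multiplicities, paying for a row or column in the cross and paying for its left
  -- vertices outside it cost the same up to 1. The subtraction never truncates, since `s ≤ p / h +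
  -- 1` and both fibres have size at least `p / h ≥ 1`.
  let n : Fin l × Fin h → ℕ := fun y => a y.1 + b y.2 - s
  have hn : ∀ y, n y + s = a y.1 + b y.2 := by
    intro y
    have := ha y.1
    have := hb y.2
    simp only [n]
    omega
  have hasum : ∑ c, a c = p := by
    have := sum_not_mem_add_sum_card (fun i => (φ i).1) Finset.univ
    simpa using this
  have hbsum : ∑ d, b d = p := by
    have := sum_not_mem_add_sum_card (fun i => (φ i).2) Finset.univ
    simpa using this
  have hnsum : ∑ y, n y ≤ q := by
    have h1 : ∑ y, (n y + s) = ∑ y : Fin l × Fin h, (a y.1 + b y.2) :=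
      Finset.sum_congr rfl fun y _ => hn y
    rw [Finset.sum_add_distrib, Fintype.sum_prod_type (fun y : Fin l × Fin h => a y.1 + b y.2)] at h1
    simp only [Finset.sum_add_distrib, Finset.sum_const, Finset.card_univ, Fintype.card_prod,
      Fintype.card_fin, smul_eq_mul, ← Finset.mul_sum, hasum, hbsum] at h1
    nlinarith
  have : Nonempty (Fin l × Fin h) := ⟨(⟨0, hl⟩, ⟨0, hh⟩)⟩
  obtain ⟨ψ, hψ⟩ := exists_fun_with_large_fibres n hnsum
  obtain ⟨G, z, hz, -, hle⟩ := exists_staircase (by omega) φ ψ m hm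
  set S := Finset.univ.filter fun c => (c, z.2) ∈ G with hS
  set T := Finset.univ.filter fun d => (z.1, d) ∈ G with hT
  have hzS : z.1 ∈ S := by simp [hS, hz]
  have hzT : z.2 ∈ T := by simp [hT, hz]
  have e1 : (∑ i, if (φ i).1 ∈ S then 0 else 1) + (∑ i, if (φ i).2 ∈ T then 0 else 1) ≤
      ∑ i, leftExcess G z (φ i) := by
    rw [← Finset.sum_add_distrib]
    refine Finset.sum_le_sum fun i _ => le_max_of_le_left ?_
    simp [hS, hT]
  have e2 := sum_not_mem_add_sum_card (fun i => (φ i).1) S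
  have e3 := sum_not_mem_add_sum_card (fun i => (φ i).2) T
  have e4 : ∑ c ∈ S, n (c, z.2) + ∑ d ∈ T.erase z.2, n (z.1, d) ≤ ∑ y ∈ G, n y :=
    sum_cross_le n G z
  have e5 := sum_card_add_sum_le_of_le S z.1 hzS a (fun c => n (c, z.2)) (fun c => by
    have := hn (c, z.2)
    have := hb z.2
    simp only at *
    omega)
  have e6 := sum_card_add_sum_le_of_le T z.2 hzT b (fun d => n (z.1, d)) (fun d => by
    have := hn (z.1, d)
    have := ha z.1
    simp only at *
    omega)
  have e7 := Finset.add_sum_erase T (fun d => n (z.1, d)) hzT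
  have e8 := hn z
  have e9 := hψ G
  have e10 : S.card ≤ l := by simpa using S.card_le_univ
  have e11 : T.card ≤ h := by simpa using T.card_le_univ
  simp only [Prod.mk.eta] at *
  change _ + ∑ c ∈ S, a c = p at e2
  change _ + ∑ c ∈ T, b c = p at e3
  omega

end Constructions

/-! ### Sums with intervals in a cyclic group -/

section Cyclic

variable {h : ℕ}

/-- The number of pairs of an element of `Z` and a shift `b < a` that lead into `T`. -/
def shiftCount (Z T : Finset (ZMod h)) (a : ℕ) : ℕ :=
  ∑ z ∈ Z, ((Finset.range a).filter fun b : ℕ => z + (b : ZMod h) ∈ T).card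

lemma natCast_injOn_range {a : ℕ} (ha : a ≤ h) :
    Set.InjOn (fun b : ℕ => (b : ZMod h)) (Finset.range a : Set ℕ) := by
  intro b hb c hc hbc
  simp only [Finset.coe_range, Set.mem_Iio] at hb hc
  have := congrArg ZMod.val hbc
  simpa [ZMod.val_natCast_of_lt (show b < h by omega),
    ZMod.val_natCast_of_lt (show c < h by omega)] using this

lemma shiftCount_eq_sum (Z T : Finset (ZMod h)) (a : ℕ) :
    shiftCount Z T a = ∑ x ∈ T, ((Finset.range a).filter fun b : ℕ => x - (b : ZMod h) ∈ Z).card := by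
  have e1 : shiftCount Z T a = ∑ b ∈ Finset.range a, (Z.filter fun z => z + (b : ZMod h) ∈ T).card := by
    simp only [shiftCount, Finset.card_filter]
    exact Finset.sum_comm
  have e2 : ∑ x ∈ T, ((Finset.range a).filter fun b : ℕ => x - (b : ZMod h) ∈ Z).card =
      ∑ b ∈ Finset.range a, (T.filter fun x => x - (b : ZMod h) ∈ Z).card := by
    simp only [Finset.card_filter]
    exact Finset.sum_comm
  rw [e1, e2]
  refine Finset.sum_congr rfl fun b _ => ?_
  refine Finset.card_bij' (fun z _ => z + b) (fun x _ => x - b) ?_ ?_ ?_ ?_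
  all_goals simp +contextual

/-- The sum set of `Z` and the interval `[0, a)`. -/
def addInterval (Z : Finset (ZMod h)) (a : ℕ) : Finset (ZMod h) :=
  (Finset.range a).biUnion fun b => Z.image fun z => z + b

lemma mem_addInterval {Z : Finset (ZMod h)} {a : ℕ} {x : ZMod h} :
    x ∈ addInterval Z a ↔ ∃ b < a, ∃ z ∈ Z, z + b = x := by
  simp only [addInterval, Finset.mem_biUnion, Finset.mem_range, Finset.mem_image]

variable [NeZero h]

lemma eq_univ_of_add_one_mem (W : Finset (ZMod h)) (hW : W.Nonempty)
    (h1 : ∀ w ∈ W, w + 1 ∈ W) : W = Finset.univ := by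
  obtain ⟨w, hw⟩ := hW
  have key : ∀ n : ℕ, w + n ∈ W := by
    intro n
    induction n with
    | zero => simpa using hw
    | succ n ih =>
      have := h1 _ ih
      push_cast
      rwa [← add_assoc]
  ext x
  have := key (x - w).val
  rw [ZMod.natCast_zmod_val] at this
  simpa using this

/-- A Cauchy–Davenport bound valid for every modulus because one summand is an interval: each
lengthening adds an element unless the set is closed under `+ 1`, hence everything. -/
lemma le_card_addInterval (Z : Finset (ZMod h)) (hZ : Z.Nonempty) (a : ℕ) :
    min h (Z.card + a) ≤ (addInterval Z (a + 1)).card := by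
  induction a with
  | zero =>
    refine min_le_of_right_le (Finset.card_le_card fun z hz => mem_addInterval.mpr ?_)
    exact ⟨0, by omega, z, hz, by simp⟩
  | succ a ih =>
    have hsub : addInterval Z (a + 1) ⊆ addInterval Z (a + 1 + 1) := by
      intro x hx
      obtain ⟨b, hb, z, hz, rfl⟩ := mem_addInterval.mp hx
      exact mem_addInterval.mpr ⟨b, by omega, z, hz, rfl⟩
    have hne : (addInterval Z (a + 1)).Nonempty := by
      obtain ⟨z, hz⟩ := hZ
      exact ⟨z, mem_addInterval.mpr ⟨0, by omega, z, hz, by simp⟩⟩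
    by_cases hstab : ∀ w ∈ addInterval Z (a + 1), w + 1 ∈ addInterval Z (a + 1)
    · have huniv := eq_univ_of_add_one_mem _ hne hstab
      have := Finset.card_le_card hsub
      rw [huniv, Finset.card_univ, ZMod.card] at this
      exact min_le_of_left_le this
    · push Not at hstab
      obtain ⟨w, hw, hw'⟩ := hstab
      have hss : addInterval Z (a + 1) ⊂ addInterval Z (a + 1 + 1) := by
        refine Finset.ssubset_iff_subset_ne.mpr ⟨hsub, fun heq => hw' (heq ▸ ?_)⟩
        obtain ⟨b, hb, z, hz, rfl⟩ := mem_addInterval.mp hw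
        exact mem_addInterval.mpr ⟨b + 1, by omega, z, hz, by push_cast; ring⟩
      have := Finset.card_lt_card hss
      omega

/-- For small `Z.card + a`, the sumset of `Z` and the interval must overlap `T`. Otherwise each
element of `T` is hit at least `w = Z.card + a - h ≥ 1` times, and `|T| * w + 1 ≥ |T| + w`. -/
lemma le_shiftCount (Z T : Finset (ZMod h)) (hZ : Z.Nonempty) (hT : T.Nonempty) (a : ℕ)
    (ha0 : 0 < a) (ha : a ≤ h) : T.card + Z.card + a ≤ shiftCount Z T a + h + 1 := by
  have hTh : T.card ≤ h := by simpa [ZMod.card] using T.card_le_univ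
  have hZh : Z.card ≤ h := by simpa [ZMod.card] using Z.card_le_univ
  rw [shiftCount_eq_sum]
  rcases le_total (Z.card + a) (h + 1) with hle | hle
  · cases a with
    | zero => omega
    | succ a =>
      have h1 := le_card_addInterval Z hZ a
      have h2 : (T ∩ addInterval Z (a + 1)).card ≤
          ∑ x ∈ T, ((Finset.range (a + 1)).filter fun b : ℕ => x - (b : ZMod h) ∈ Z).card := by
        rw [← Finset.filter_mem_eq_inter, Finset.card_filter]
        refine Finset.sum_le_sum fun x _ => ?_
        split_ifs with hx
        · obtain ⟨b, hb, z, hz, rfl⟩ := mem_addInterval.mp hx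
          exact Finset.card_pos.mpr ⟨b, by simpa [hz] using hb⟩
        · simp
      have h3 := Finset.card_union_add_card_inter T (addInterval Z (a + 1))
      have h4 : (T ∪ addInterval Z (a + 1)).card ≤ h := by
        simpa [ZMod.card] using (T ∪ addInterval Z (a + 1)).card_le_univ
      omega
  · have h1 : ∀ x ∈ T, Z.card + a - h ≤
        ((Finset.range a).filter fun b : ℕ => x - (b : ZMod h) ∈ Z).card := by
      intro x _
      have hinj : Set.InjOn (fun b : ℕ => x - (b : ZMod h)) (Finset.range a : Set ℕ) :=
        fun b hb c hc hbc => natCast_injOn_range ha hb hc (sub_right_injective hbc)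
      have h2 := Finset.card_image_of_injOn hinj
      have h3 := Finset.card_union_add_card_inter ((Finset.range a).image fun b : ℕ => x - (b : ZMod h)) Z
      have h4 : ((Finset.range a).image (fun b : ℕ => x - (b : ZMod h)) ∪ Z).card ≤ h := by
        simpa [ZMod.card] using
          ((Finset.range a).image (fun b : ℕ => x - (b : ZMod h)) ∪ Z).card_le_univ
      have h5 : (Finset.range a).image (fun b : ℕ => x - (b : ZMod h)) ∩ Z ⊆
          ((Finset.range a).filter fun b : ℕ => x - (b : ZMod h) ∈ Z).image
            fun b : ℕ => x - (b : ZMod h) := by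
        intro y hy
        simp only [Finset.mem_inter, Finset.mem_image, Finset.mem_filter] at hy ⊢
        obtain ⟨⟨b, hb, rfl⟩, hb'⟩ := hy
        exact ⟨b, ⟨hb, hb'⟩, rfl⟩
      have h6 := (Finset.card_le_card h5).trans Finset.card_image_le
      simp only [Finset.card_range] at h2
      omega
    have h2 := Finset.sum_le_sum h1
    simp only [Finset.sum_const, smul_eq_mul] at h2
    have hTpos := Finset.card_pos.mpr hT
    obtain ⟨w, hw⟩ := Nat.exists_eq_add_of_le (show h ≤ Z.card + a by omega)
    have hw' : Z.card + a - h = w := by omega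
    rw [hw'] at h2
    have : T.card + w ≤ T.card * w + 1 := by
      have : 1 ≤ w := by omega
      nlinarith
    omega

lemma card_filter_shift_add_mul (T : Finset (ZMod h)) (z : ZMod h) (a j : ℕ) :
    ((Finset.range (j * h + a)).filter fun b : ℕ => z + (b : ZMod h) ∈ T).card =
      j * T.card + ((Finset.range a).filter fun b : ℕ => z + (b : ZMod h) ∈ T).card := by
  induction j with
  | zero => simp
  | succ j ih =>
    have e : (j + 1) * h + a = h + (j * h + a) := by ring
    rw [e, Finset.card_filter, Finset.sum_range_add, ← Finset.card_filter, ← Finset.card_filter]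
    have h1 : ((Finset.range h).filter fun b : ℕ => z + (b : ZMod h) ∈ T).card = T.card := by
      refine Finset.card_bij (fun b _ => z + (b : ZMod h)) (by simp) ?_ ?_
      · intro b hb c hc hbc
        simp only [Finset.mem_filter] at hb hc
        exact natCast_injOn_range le_rfl hb.1 hc.1 (add_left_cancel hbc)
      · intro x hx
        refine ⟨(x - z).val, ?_, ?_⟩ <;> simp [ZMod.val_lt, hx]
    rw [h1]
    simp only [Nat.cast_add, CharP.cast_eq_zero, zero_add]
    rw [ih]
    ring

lemma shiftCount_add_mul (Z T : Finset (ZMod h)) (a j : ℕ) :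
    shiftCount Z T (j * h + a) = j * T.card * Z.card + shiftCount Z T a := by
  simp only [shiftCount, card_filter_shift_add_mul, Finset.sum_add_distrib, Finset.sum_const,
    smul_eq_mul]
  ring

/-- Adding `shiftCount X T a` to both sides gives `a * (|X| + |T|)` twice. -/
lemma shiftCount_compl_add (X T : Finset (ZMod h)) (a : ℕ) :
    shiftCount X Tᶜ a + a * T.card = a * X.card + shiftCount Xᶜ T a := by
  have h1 : shiftCount X Tᶜ a + shiftCount X T a = a * X.card := by
    simp only [shiftCount, ← Finset.sum_add_distrib]
    have : ∀ x : ZMod h, ((Finset.range a).filter fun b : ℕ => x + (b : ZMod h) ∈ Tᶜ).card +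
        ((Finset.range a).filter fun b : ℕ => x + (b : ZMod h) ∈ T).card = a := by
      intro x
      rw [add_comm]
      simpa using Finset.card_filter_add_card_filter_not (s := Finset.range a)
        fun b : ℕ => x + (b : ZMod h) ∈ T
    rw [Finset.sum_congr rfl fun x _ => this x, Finset.sum_const, smul_eq_mul, mul_comm]
  have h2 : shiftCount X T a + shiftCount Xᶜ T a = a * T.card := by
    have h3 := shiftCount_eq_sum Finset.univ T a
    simp only [Finset.mem_univ, Finset.filter_true, Finset.card_range, Finset.sum_const,
      smul_eq_mul] at h3
    rw [mul_comm, ← h3]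
    exact Finset.sum_add_sum_compl X _
  omega

end Cyclic

/-! ### Left side spread cyclically over the colour pairs -/

section Skew

variable {p q l h : ℕ}

/-- Numerical core of the skew bound. `X` is the set of rows and `Tᶜ` the set of columns missed by
the cross, so the shift count measures left vertices paying twice, while `D * w` is paid by the
uniform part of the right side on the `w` cells of the cross. A small cross is compensated by many
missed vertices. -/
lemma le_shiftCount_add_cross [NeZero h] (X T : Finset (ZMod h)) (hT : T.Nonempty) (s w j a D Y : ℕ)
    (hs : 0 < s) (hsX : s + X.card = l) (hlh : l ≤ h) (hw : w + 1 = s + T.card) (ha : a < h)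
    (hD : D ≤ j * (h - 1) + a) (hY : Y ≤ l * D)
    (hYD : Y + a ≤ l * D ∨ D + 1 ≤ j * (h - 1) + a) :
    Y ≤ shiftCount X Tᶜ (j * h + a) + D * w := by
  have hTh : T.card ≤ h := by simpa [ZMod.card] using T.card_le_univ
  have hTpos := Finset.card_pos.mpr hT
  have hcompl : X.card + Xᶜ.card = h := by
    rw [Finset.card_add_card_compl, ZMod.card]
  rcases le_or_gt l w with hlw | hlw
  · have : D * l ≤ D * w := Nat.mul_le_mul_left D hlw
    rw [mul_comm] at hY
    omega
  have h1 := shiftCount_compl_add X T (j * h + a)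
  rw [shiftCount_add_mul Xᶜ] at h1
  have h2 : (0 < a) → T.card + Xᶜ.card + a ≤ shiftCount Xᶜ T a + h + 1 := fun ha0 =>
    le_shiftCount Xᶜ T (Finset.card_pos.mp (by omega)) hT a ha0 ha.le
  generalize shiftCount X Tᶜ (j * h + a) = P at *
  generalize shiftCount Xᶜ T a = Q at *
  generalize Xᶜ.card = z at *
  generalize X.card = u at *
  generalize T.card = t at *
  -- `v` is the number of rows that the cross misses, minus one
  obtain ⟨v, rfl⟩ : ∃ v, u = t + v := Nat.exists_eq_add_of_le (by omega)
  obtain ⟨z', rfl⟩ : ∃ z', z = z' + 1 := Nat.exists_eq_add_of_le' (by omega)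
  obtain ⟨t', rfl⟩ : ∃ t', t = t' + 1 := Nat.exists_eq_add_of_le' hTpos
  obtain rfl : h = t' + 1 + v + z' + 1 := by omega
  obtain rfl : l = w + v + 1 := by omega
  have e1 : t' + 1 + v + z' + 1 - 1 = t' + 1 + v + z' := by omega
  rw [e1] at hD hYD
  have hgap : 0 ≤ j * (t' * z') := Nat.zero_le _
  -- Full periods contribute `j * (h * v + |T| * |Xᶜ|)`, and `|T| * |Xᶜ|` exceeds `|T| + |Xᶜ| - 1`
  -- by `t' * z'`.
  have hPj : j * (v + 1) * (t' + 1 + v + z') + a * v + Q ≤ P := by nlinarith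
  rcases hYD with hYD | hYD
  · have := Nat.mul_le_mul_left (v + 1) hD
    nlinarith
  · rcases Nat.eq_zero_or_pos a with rfl | ha0
    · have := Nat.mul_le_mul_left (v + 1) hD
      nlinarith
    · have h3 := h2 ha0
      have h4 : a ≤ Q + v + 1 := by omega
      have := Nat.mul_le_mul_left (v + 1) hYD
      nlinarith

/-- Vertex `c + l * b` has row `c` and column `c + b`, so each row runs through at least `p / l`
consecutive columns. -/
lemma shiftCount_le_card_filter [NeZero h] (hp : 0 < p) (hl : 0 < l) (hlh : l ≤ h) (φ : Fin p → Fin l × ZMod h)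
    (hφ : ∀ i, (φ i).1 = ⟨i % l, Nat.mod_lt _ hl⟩ ∧ (φ i).2 = ((i % l + i / l : ℕ) : ZMod h))
    (S : Finset (Fin l)) (T : Finset (ZMod h)) :
    shiftCount (Sᶜ.image fun c : Fin l => ((c : ℕ) : ZMod h)) Tᶜ (p / l) ≤
      (Finset.univ.filter fun i => (φ i).1 ∉ S ∧ (φ i).2 ∉ T).card := by
  classical
  have hinj : Set.InjOn (fun c : Fin l => ((c : ℕ) : ZMod h)) (Sᶜ : Finset (Fin l)) := by
    intro c _ d _ hcd
    exact Fin.ext (natCast_injOn_range hlh (by simp) (by simp) hcd)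
  rw [shiftCount, Finset.sum_image hinj, ← Finset.card_sigma]
  have hlt : ∀ (c : Fin l) b, b < p / l → (c : ℕ) + l * b < p := by
    intro c b hb
    have h1 := Nat.mul_div_le p l
    have h2 : l * (b + 1) ≤ l * (p / l) := Nat.mul_le_mul_left l hb
    have h3 := c.2
    rw [Nat.mul_add] at h2
    omega
  have hmod : ∀ (c : Fin l) b, ((c : ℕ) + l * b) % l = c := fun c b => by
    rw [Nat.add_mul_mod_self_left, Nat.mod_eq_of_lt c.2]
  have hdiv : ∀ (c : Fin l) b, ((c : ℕ) + l * b) / l = b := fun c b => by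
    rw [Nat.add_mul_div_left _ _ hl, Nat.div_eq_of_lt c.2, zero_add]
  -- The reduction modulo `p` only makes the map total; it changes nothing on the set in question.
  refine Finset.card_le_card_of_injOn (fun x => ⟨(x.1 + l * x.2) % p, Nat.mod_lt _ hp⟩) ?_ ?_
  · rintro ⟨c, b⟩ hx
    simp only [Finset.coe_sigma, Set.mem_sigma_iff, Finset.mem_coe, Finset.mem_compl,
      Finset.mem_filter, Finset.mem_range] at hx
    obtain ⟨hc, hb, hT⟩ := hx
    have h1 := hφ ⟨(c + l * b) % p, Nat.mod_lt _ hp⟩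
    simp only [Nat.mod_eq_of_lt (hlt c b hb), hmod, hdiv] at h1
    simp only [Finset.coe_filter, Finset.mem_univ, true_and, Set.mem_ofPred_eq,
      Nat.mod_eq_of_lt (hlt c b hb), h1]
    exact ⟨hc, by push_cast; exact hT⟩
  · rintro ⟨c, b⟩ hx ⟨c', b'⟩ hx' heq
    simp only [Finset.coe_sigma, Set.mem_sigma_iff, Finset.mem_coe, Finset.mem_filter,
      Finset.mem_range] at hx hx'
    simp only [Fin.mk.injEq, Nat.mod_eq_of_lt (hlt c b hx.2.1),
      Nat.mod_eq_of_lt (hlt c' b' hx'.2.1)] at heq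
    have h1 := congrArg (· % l) heq
    have h2 := congrArg (· / l) heq
    simp only [hmod, hdiv] at h1 h2
    rw [Fin.ext h1, h2]

/-- Lower bound from a left side whose vertices are spread evenly over the pairs of colours, and a
right side that reverses the left side up to an even distribution of the remaining vertices. -/
theorem le_of_skew_of_parameters (hl : 0 < l) (hlh : l ≤ h) (hp : 0 < p) (j a D Y : ℕ)
    (ha : a < h) (hpl : p / l = j * h + a) (hD : D ≤ j * (h - 1) + a) (hY : Y ≤ l * D)
    (hYD : Y + a ≤ l * D ∨ D + 1 ≤ j * (h - 1) + a) (hq : p + l * h * D ≤ q) (m : ℕ)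
    (hm : ∀ α β, (bipartiteRecolouringGraph p q (l + h)).edist α β ≤ m) :
    2 * p + q + Y ≤ m := by
  classical
  have : NeZero h := ⟨by omega⟩
  let e : ZMod h ≃ Fin h := Fintype.equivFinOfCardEq (ZMod.card h)
  let φ' : Fin p → Fin l × ZMod h :=
    fun i => (⟨i % l, Nat.mod_lt _ hl⟩, ((i % l + i / l : ℕ) : ZMod h))
  let φ : Fin p → Fin l × Fin h := fun i => ((φ' i).1, e (φ' i).2)
  let n : Fin l × Fin h → ℕ := fun y => (Finset.univ.filter fun i => φ i = y).card + D
  have hn : ∀ G : Finset (Fin l × Fin h),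
      ∑ y ∈ G, n y = (∑ i, if φ i ∈ G then 1 else 0) + G.card * D := by
    intro G
    simp only [n, Finset.sum_add_distrib, Finset.sum_const, smul_eq_mul, Finset.card_filter]
    rw [Finset.sum_comm]
    simp
  have hnq : ∑ y, n y ≤ q := by
    rw [hn]
    simpa using hq
  have : Nonempty (Fin l × Fin h) := ⟨(⟨0, hl⟩, ⟨0, by omega⟩)⟩
  obtain ⟨ψ, hψ⟩ := exists_fun_with_large_fibres n hnq
  obtain ⟨G, z, hz, hcl, hle⟩ := exists_staircase hp φ ψ m hm
  set S := Finset.univ.filter fun c => (c, z.2) ∈ G with hS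
  set T := Finset.univ.filter fun x : ZMod h => (z.1, e x) ∈ G with hT
  have hcross : S.card + (Finset.univ.filter fun d => (z.1, d) ∈ G).card ≤ G.card + 1 := by
    have h1 := sum_cross_le (fun _ => 1) G z
    have h2 := Finset.card_erase_add_one (s := Finset.univ.filter fun d => (z.1, d) ∈ G)
      (a := z.2) (by simp [hz])
    simp only [Finset.sum_const, smul_eq_mul, mul_one, ← hS] at h1
    omega
  have hTcard : (Finset.univ.filter fun d => (z.1, d) ∈ G).card = T.card := by
    refine Finset.card_bij' (fun d _ => e.symm d) (fun x _ => e x) ?_ ?_ ?_ ?_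
    all_goals simp [hT]
  have hTne : T.Nonempty := ⟨e.symm z.2, by simp [hT, hz]⟩
  have hSpos : 0 < S.card := Finset.card_pos.mpr ⟨z.1, by simp [hS, hz]⟩
  have hXcard : (Sᶜ.image fun c : Fin l => ((c : ℕ) : ZMod h)).card = Sᶜ.card :=
    Finset.card_image_of_injective _ fun c d hcd =>
      Fin.ext (natCast_injOn_range hlh (by simp) (by simp) hcd)
  have hTpos := Finset.card_pos.mpr hTne
  have key := le_shiftCount_add_cross (l := l) (Sᶜ.image fun c : Fin l => ((c : ℕ) : ZMod h)) T hTne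
    S.card (S.card + T.card - 1) j a D Y hSpos
    (by rw [hXcard, Finset.card_add_card_compl, Fintype.card_fin]) hlh (by omega) ha hD hY hYD
  rw [← hpl] at key
  have hcount := shiftCount_le_card_filter hp hl hlh φ' (fun i => ⟨rfl, rfl⟩) S T
  -- Matching each left vertex with a right vertex of the same pair, at least one of the two pays,
  -- and the left one pays twice if its pair misses both the rows `S` and the columns `T`.
  have hpair : ∀ i, 1 + (if (φ' i).1 ∉ S ∧ (φ' i).2 ∉ T then 1 else 0) ≤
      leftExcess G z (φ i) + if φ i ∈ G then 1 else 0 := by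
    intro i
    have e1 : (φ' i).1 ∈ S ↔ ((φ i).1, z.2) ∈ G := by simp [hS, φ]
    have e2 : (φ' i).2 ∈ T ↔ (z.1, (φ i).2) ∈ G := by simp [hT, φ]
    simp only [e1, e2, leftExcess]
    have := hcl (φ i)
    by_cases h1 : φ i ∈ G
    · simp [h1, this h1]
    · simp only [h1, if_false, add_zero]
      split_ifs <;> simp_all
  have hsum := Finset.sum_le_sum fun i (_ : i ∈ Finset.univ) => hpair i
  rw [Finset.sum_add_distrib, Finset.sum_add_distrib, ← Finset.card_filter] at hsum
  simp only [Finset.sum_const, Finset.card_univ, Fintype.card_fin, smul_eq_mul, mul_one] at hsum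
  have hG := hψ G
  rw [hn] at hG
  have hmul : D * (S.card + T.card - 1) ≤ G.card * D := by
    rw [mul_comm]
    exact Nat.mul_le_mul_right D (by omega)
  omega

/-- The diameter bound obtained from the best choice of parameters in
`le_of_skew_of_parameters`. -/
theorem le_of_skew (hl : 0 < l) (hlh : l ≤ h) (hhl : h ≤ l + 1) (hp : 0 < p)
    (hpq : p ≤ q) (hqp : q ≤ h * p) (m : ℕ)
    (hm : ∀ α β, (bipartiteRecolouringGraph p q (l + h)).edist α β ≤ m) :
    2 * p + q + (q - p) / h ≤ m + l := by
  have hh : 0 < h := by omega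
  set y := (q - p) / h with hy
  -- Giving up `l` allows `D`, the ceiling of `Y / l`, to satisfy `l * D ≤ y`, so that `p + l * h *
  -- D ≤ q`.
  set Y := y - l with hYdef
  set j := p / l / h with hj
  set a := p / l % h with ha
  set D := (Y + l - 1) / l with hD
  have hyq : h * y ≤ q - p := Nat.mul_div_le _ _
  have hpl : p / l = j * h + a := (Nat.div_add_mod' _ _).symm
  have hah : a < h := Nat.mod_lt _ hh
  have hDY : l * D ≤ Y + l - 1 := Nat.mul_div_le _ _
  have hYD : Y ≤ l * D := by
    have := Nat.lt_mul_div_succ (Y + l - 1) hl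
    rw [← hD, mul_add] at this
    omega
  clear_value D Y y j a
  have hpa : p ≤ l * (j * h + a) + l - 1 := by
    have := Nat.lt_mul_div_succ p hl
    rw [hpl, mul_add] at this
    omega
  -- This yields both `D ≤ j * (h - 1) + a` and, in case of equality, the slack `Y + a ≤ l * D`. It
  -- uses `q ≤ h * p` and `h ≤ l + 1`.
  have hYE : Y + a ≤ l * (j * (h - 1) + a) := by
    obtain ⟨h', rfl⟩ : ∃ h', h = h' + 1 := Nat.exists_eq_add_of_le' hh
    rw [Nat.add_sub_cancel]
    rcases Nat.eq_zero_or_pos Y with h0 | h0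
    · rw [h0]
      nlinarith [Nat.zero_le (l * (j * h')), Nat.mul_le_mul_right a hl]
    · have e1 : y = Y + l := by omega
      have e2 : (h' + 1) * (Y + l) ≤ h' * p := by
        rw [← e1]
        have : (h' + 1) * y + p ≤ (h' + 1) * p := by omega
        nlinarith
      have e3 : p + 1 ≤ l * (j * (h' + 1) + a) + l := by omega
      have e4 := Nat.mul_le_mul_left h' e3
      have e5 : h' * a ≤ l * a := Nat.mul_le_mul_right a (by omega)
      by_contra hcon
      have e6 := Nat.mul_le_mul_left (h' + 1) (show l * (j * h' + a) + 1 ≤ Y + a by omega)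
      nlinarith
  have hDE : D ≤ j * (h - 1) + a := by
    have h1 : l * D < l * (j * (h - 1) + a + 1) := by
      rw [mul_add l _ 1]
      omega
    have := lt_of_mul_lt_mul_left h1 (Nat.zero_le l)
    omega
  have hmain := le_of_skew_of_parameters (q := q) hl hlh hp j a D Y hah hpl hDE hYD (by
    rcases hDE.eq_or_lt with h1 | h1
    · left
      rwa [h1]
    · right
      exact h1) (by
    have e1 : l * D ≤ y := by
      rcases Nat.eq_zero_or_pos Y with h0 | h0
      · have : l * D < l * 1 := by omega
        have := lt_of_mul_lt_mul_left this (Nat.zero_le l)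
        have : D = 0 := by omega
        simp [this]
      · omega
    have e2 := Nat.mul_le_mul_left h e1
    have e3 : l * h * D = h * (l * D) := by ring
    omega) m hm
  omega

end Skew

/-! ### The three ranges of q -/

section Diameter

variable {p q k : ℕ}

lemma edist_le_diam (hk : 3 ≤ k) (hp : 0 < p)
    (α β : (completeBipartiteGraph (Fin p) (Fin q)).Coloring (Fin k)) :
    (bipartiteRecolouringGraph p q k).edist α β ≤ (bipartiteRecolouringGraph p q k).diam := by
  rw [SimpleGraph.diam, ENat.natCast_toNat (diam_attained hk hp).1]
  exact SimpleGraph.edist_le_ediam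

lemma diam_cases (hk : 3 ≤ k) (hp : 0 < p) :
    (bipartiteRecolouringGraph p q k).diam ≤ 2 * p + q ∨
      (∃ M : ℕ, k ≤ M + 1 ∧ M ≤ k ^ 2 / 4 ∧
        M * (bipartiteRecolouringGraph p q k).diam + k * p ≤ M * (3 * p + q) + q) ∧
      ∃ M : ℕ, k ≤ 2 * M ∧
        M * (bipartiteRecolouringGraph p q k).diam + p ≤ M * (2 * p + q) + q := by
  obtain ⟨-, α, β, h⟩ := diam_attained (q := q) hk hp
  obtain ⟨m, hm, hcases⟩ := edist_cases hk hp α β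
  rw [h, Nat.cast_inj] at hm
  rwa [hm]

lemma le_diam_of_monochromatic (hk : 3 ≤ k) (hp : 0 < p) (hpq : p ≤ q) :
    2 * p + q + (q - p) / (k - 1) ≤ (bipartiteRecolouringGraph p q k).diam := by
  obtain ⟨h, rfl⟩ : ∃ h, k = 1 + h := ⟨k - 1, by omega⟩
  rw [Nat.add_sub_cancel_left]
  exact le_of_monochromatic hp hpq (by omega) _ (edist_le_diam hk hp)

lemma half_add_half (k : ℕ) : k = k / 2 + (k + 1) / 2 := by omega

lemma half_mul_half (k : ℕ) : k ^ 2 / 4 = k / 2 * ((k + 1) / 2) := by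
  rcases Nat.even_or_odd' k with ⟨r, rfl | rfl⟩
  · have e1 : 2 * r / 2 = r := by omega
    have e2 : (2 * r + 1) / 2 = r := by omega
    rw [e1, e2, show (2 * r) ^ 2 = r * r * 4 by ring]
    omega
  · have e1 : (2 * r + 1) / 2 = r := by omega
    have e2 : (2 * r + 1 + 1) / 2 = r + 1 := by omega
    rw [e1, e2, show (2 * r + 1) ^ 2 = r * (r + 1) * 4 + 1 by ring]
    omega

lemma le_diam_of_balanced (hk : 3 ≤ k) (hkp : (k + 1) / 2 ≤ p) (s : ℕ)
    (hs : (k + 1) / 2 * s ≤ p + (k + 1) / 2 - 1) (hsum : k * p ≤ q + k ^ 2 / 4 * s) :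
    3 * p + q + 2 ≤ (bipartiteRecolouringGraph p q k).diam + s + k := by
  have hd := edist_le_diam (q := q) hk (show 0 < p by omega)
  rw [half_mul_half] at hsum
  have hkk := half_add_half k
  have h1 : 0 < k / 2 := by omega
  have h2 : k / 2 ≤ (k + 1) / 2 := by omega
  generalize k / 2 = l at *
  generalize (k + 1) / 2 = h at *
  subst hkk
  have := le_of_balanced h1 h2 hkp s hs hsum _ hd
  omega

lemma le_diam_of_skew (hk : 3 ≤ k) (hp : 0 < p) (hpq : p ≤ q) (hq : q ≤ (k + 1) / 2 * p) :
    2 * p + q + (q - p) / ((k + 1) / 2) ≤ (bipartiteRecolouringGraph p q k).diam + k / 2 := by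
  have hd := edist_le_diam (q := q) hk hp
  have hkk := half_add_half k
  have h1 : 0 < k / 2 := by omega
  have h2 : k / 2 ≤ (k + 1) / 2 := by omega
  have h3 : (k + 1) / 2 ≤ k / 2 + 1 := by omega
  generalize k / 2 = l at *
  generalize (k + 1) / 2 = h at *
  subst hkk
  exact le_of_skew h1 h2 h3 hp hpq hq _ hd

/-- The average reads `M * (d - 3p - q) ≤ q - k * p`. As the right side is nonnegative here, the
weakest case is the smallest `M`, namely `k - 1`. -/
lemma diam_eq_of_mul_le (hk : 3 ≤ k) (hp : 0 < p) (hpq : p ≤ q) (hq : k * p ≤ q) :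
    ((bipartiteRecolouringGraph p q k).diam : ℤ) =
      2 * (p : ℤ) + (q : ℤ) + ((q : ℤ) - (p : ℤ)) / ((k : ℤ) - 1) := by
  have hlow := le_diam_of_monochromatic hk hp hpq
  have hup := diam_cases (q := q) hk hp
  generalize (bipartiteRecolouringGraph p q k).diam = d at *
  refine le_antisymm ?_ ?_
  · suffices (d : ℤ) - 2 * p - q ≤ ((q : ℤ) - p) / ((k : ℤ) - 1) by linarith
    rw [Int.le_ediv_iff_mul_le (by omega)]
    rcases hup with h1 | ⟨⟨M, h1, -, h2⟩, -⟩
    · have e1 : (d : ℤ) - 2 * p - q ≤ 0 := by omega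
      have e2 : (0 : ℤ) ≤ (k : ℤ) - 1 := by omega
      have := mul_nonneg_of_nonpos_of_nonpos e1 (neg_nonpos.mpr e2)
      nlinarith
    · zify at h1 h2 hq
      by_cases ht : (d : ℤ) - 3 * p - q ≤ 0
      · have e2 : (0 : ℤ) ≤ (k : ℤ) - 1 := by omega
        nlinarith [mul_nonneg (neg_nonneg.mpr ht) e2]
      · push Not at ht
        nlinarith [mul_nonneg ht.le (show (0 : ℤ) ≤ M + 1 - k by omega)]
  · zify [hpq, show 1 ≤ k by omega] at hlow
    exact hlow

/-- Now `q - k * p ≤ 0`, so the same average is weakest for the largest `M`, namely `k ^ 2 / 4`. -/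
lemma diam_le_of_middle (hk : 3 ≤ k) (hp : 0 < p) (hq : (k + 1) / 2 * p ≤ q) (hq' : q ≤ k * p) :
    ((bipartiteRecolouringGraph p q k).diam : ℤ) ≤
      3 * (p : ℤ) + (q : ℤ) + ((q : ℤ) - (k : ℤ) * (p : ℤ)) / ((k ^ 2 / 4 : ℕ) : ℤ) := by
  have hup := diam_cases (q := q) hk hp
  generalize (bipartiteRecolouringGraph p q k).diam = d at *
  have hN := half_mul_half k
  have hkk := half_add_half k
  have h1 : 0 < k / 2 := by omega
  have h2 : 1 < (k + 1) / 2 := by omega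
  generalize k ^ 2 / 4 = N at *
  suffices (d : ℤ) - 3 * p - q ≤ ((q : ℤ) - k * p) / (N : ℤ) by linarith
  generalize k / 2 = l at *
  generalize (k + 1) / 2 = h at *
  have hNl : l ≤ N := by rw [hN]; exact Nat.le_mul_of_pos_right l (by omega)
  rw [Int.le_ediv_iff_mul_le (by omega)]
  rcases hup with h3 | ⟨⟨M, h5, h3, h4⟩, -⟩
  · have e1 : (d : ℤ) - 3 * p - q ≤ -p := by omega
    have e2 : ((d : ℤ) - 3 * p - q) * N ≤ -p * N := mul_le_mul_of_nonneg_right e1 (by omega)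
    have e3 := Nat.mul_le_mul_left p hNl
    zify at e3 hq hkk
    rw [hkk]
    nlinarith
  · zify at h3 h4 hq'
    by_cases ht : (d : ℤ) - 3 * p - q ≤ 0
    · nlinarith [mul_nonneg (neg_nonneg.mpr ht) (sub_nonneg.mpr h3)]
    · push Not at ht
      have hM : (0 : ℤ) < M := by omega
      nlinarith [mul_pos ht hM]

/-- The balanced construction loses `k - 2`, which is at most `k ^ 2 / 4`; when `p` is below `(k +
1) / 2` the bound `2p + q` already suffices. -/
lemma le_diam_of_middle (hk : 3 ≤ k) (hp : 0 < p) (hpq : p ≤ q) (hq : (k + 1) / 2 * p ≤ q)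
    (hq' : q ≤ k * p) :
    3 * (p : ℤ) + (q : ℤ) + ((q : ℤ) - (k : ℤ) * (p : ℤ)) / ((k ^ 2 / 4 : ℕ) : ℤ) ≤
      (bipartiteRecolouringGraph p q k).diam + (k ^ 2 / 4 : ℕ) := by
  have hlow := le_diam_of_monochromatic hk hp hpq
  have hlow' := le_diam_of_balanced (p := p) (q := q) hk
  generalize (bipartiteRecolouringGraph p q k).diam = d at *
  have hN := half_mul_half k
  have hkk := half_add_half k
  have h1 : 0 < k / 2 := by omega
  have h2 : 1 < (k + 1) / 2 := by omega
  generalize k ^ 2 / 4 = N at *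
  generalize k / 2 = l at *
  generalize (k + 1) / 2 = h at *
  have hNpos : 0 < N := by rw [hN]; positivity
  have hX0 : ((q : ℤ) - k * p) / (N : ℤ) ≤ 0 := Int.ediv_le_of_le_mul (by omega) (by
    zify at hq'; linarith)
  have hX1 := Int.ediv_mul_le ((q : ℤ) - k * p) (show (N : ℤ) ≠ 0 by omega)
  have hX2 := Int.lt_ediv_add_one_mul_self ((q : ℤ) - k * p) (show (0 : ℤ) < N by omega)
  generalize ((q : ℤ) - k * p) / (N : ℤ) = X at *
  -- The floor is nonpositive, so `s` is the ceiling of `(k * p - q) / N`.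
  obtain ⟨s, hs⟩ := Int.eq_ofNat_of_zero_le (neg_nonneg.mpr hX0)
  obtain rfl : X = -s := by omega
  have hNh : h ≤ N := by rw [hN]; exact Nat.le_mul_of_pos_left h h1
  rcases lt_or_ge p h with hph | hph
  · have : 2 * p + q ≤ d := le_trans (Nat.le_add_right _ _) hlow
    omega
  · have e1 : h * s ≤ p + h - 1 := by
      have e2 : (l : ℤ) * (h * s) < l * (p + h) := by
        have e3 : (N : ℤ) = l * h := by exact_mod_cast hN
        have e4 : (k : ℤ) = l + h := by exact_mod_cast hkk
        have e5 : (h : ℤ) * p ≤ q := by exact_mod_cast hq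
        rw [e3, e4] at hX2
        nlinarith
      have e6 := lt_of_mul_lt_mul_left e2 (by omega)
      have e7 : h * s < p + h := by exact_mod_cast e6
      omega
    have e2 : k * p ≤ q + N * s := by
      zify
      nlinarith
    have e3 := hlow' hph s e1 e2
    have e4 : k ≤ N + 2 := by
      rw [hN, hkk]
      nlinarith [Nat.mul_le_mul h1 h2]
    omega

lemma diam_le_of_le (hk : 3 ≤ k) (hp : 0 < p) (hpq : p ≤ q) :
    ((bipartiteRecolouringGraph p q k).diam : ℤ) ≤
      2 * (p : ℤ) + (q : ℤ) + ((q : ℤ) - (p : ℤ)) / (((k + 1) / 2 : ℕ) : ℤ) := by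
  have hup := diam_cases (q := q) hk hp
  generalize (bipartiteRecolouringGraph p q k).diam = d at *
  have h2 : 1 < (k + 1) / 2 := by omega
  suffices (d : ℤ) - 2 * p - q ≤ ((q : ℤ) - p) / (((k + 1) / 2 : ℕ) : ℤ) by linarith
  rw [Int.le_ediv_iff_mul_le (by omega)]
  by_cases ht : (d : ℤ) - 2 * p - q ≤ 0
  · have := mul_nonpos_of_nonpos_of_nonneg ht (show (0 : ℤ) ≤ (((k + 1) / 2 : ℕ) : ℤ) by omega)
    omega
  · push Not at ht
    rcases hup with h1 | ⟨-, ⟨M, h1, h3⟩⟩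
    · omega
    · have h4 : (k + 1) / 2 ≤ M := by omega
      zify at h3
      have h5 : (((k + 1) / 2 : ℕ) : ℤ) ≤ M := by exact_mod_cast h4
      have := mul_le_mul_of_nonneg_left h5 ht.le
      linarith

lemma eq_sub_min_toNat {d F : ℤ} {N : ℕ} (h1 : d ≤ F) (h2 : F ≤ d + N) :
    d = F - (min N (F - d).toNat : ℕ) := by
  rw [min_eq_right (by omega), Int.toNat_of_nonneg (by omega)]
  ring

end Diameter

theorem theorem1 :
    ∃ g₁ g₂ : ℕ → ℕ → ℕ → ℕ, ∀ p q k : ℕ, 0 < p → 0 < q → 0 < k → p ≤ q → 3 ≤ k →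
      g₁ k p q ≤ k ^ 2 / 4 ∧ g₂ k p q ≤ k / 2 ∧
      (recolouringGraph (completeBipartiteGraph (Fin p) (Fin q)) k).ediam ≠ ⊤ ∧
      (k * p ≤ q →
        ((recolouringGraph (completeBipartiteGraph (Fin p) (Fin q)) k).diam : ℤ) =
          2 * (p : ℤ) + (q : ℤ) + ((q : ℤ) - (p : ℤ)) / ((k : ℤ) - 1)) ∧
      (((k + 1) / 2) * p ≤ q → q ≤ k * p →
        ((recolouringGraph (completeBipartiteGraph (Fin p) (Fin q)) k).diam : ℤ) =
          3 * (p : ℤ) + (q : ℤ) + ((q : ℤ) - (k : ℤ) * (p : ℤ)) / ((k ^ 2 / 4 : ℕ) : ℤ)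
            - (g₁ k p q : ℤ)) ∧
      (q ≤ ((k + 1) / 2) * p →
        ((recolouringGraph (completeBipartiteGraph (Fin p) (Fin q)) k).diam : ℤ) =
          2 * (p : ℤ) + (q : ℤ) + ((q : ℤ) - (p : ℤ)) / (((k + 1) / 2 : ℕ) : ℤ)
            - (g₂ k p q : ℤ)) := by
  -- The gaps are capped because the bounds on `g₁` and `g₂` are required for all q, also outside
  -- the ranges where the formulas apply.
  refine ⟨fun k p q => min (k ^ 2 / 4) (3 * (p : ℤ) + (q : ℤ) +
      ((q : ℤ) - (k : ℤ) * (p : ℤ)) / ((k ^ 2 / 4 : ℕ) : ℤ) -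
        ((recolouringGraph (completeBipartiteGraph (Fin p) (Fin q)) k).diam : ℤ)).toNat,
    fun k p q => min (k / 2) (2 * (p : ℤ) + (q : ℤ) +
      ((q : ℤ) - (p : ℤ)) / (((k + 1) / 2 : ℕ) : ℤ) -
        ((recolouringGraph (completeBipartiteGraph (Fin p) (Fin q)) k).diam : ℤ)).toNat, ?_⟩
  intro p q k hp _ _ hpq hk
  refine ⟨min_le_left _ _, min_le_left _ _, (diam_attained hk hp).1,
    fun h => diam_eq_of_mul_le hk hp hpq h, fun h h' => ?_, fun h => ?_⟩
  · exact eq_sub_min_toNat (diam_le_of_middle hk hp h h') (le_diam_of_middle hk hp hpq h h')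
  · refine eq_sub_min_toNat (diam_le_of_le hk hp hpq) ?_
    have h2 := le_diam_of_skew hk hp hpq h
    zify [hpq] at h2
    exact_mod_cast h2
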